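/- Let $H$ be a finite connected bipartite graph with a fixed bipartition into black and white vertices. The pair-digraph $H^+$ has as vertices the ordered pairs $(u,v)$ of distinct vertices of $H$, and its arcs are $(u,v)\to(u',v)$ whenever $u,v$ have the same colour, $uu'\in E(H)$ and $vu'\notin E(H)$, and $(u,v)\to(u,v')$ whenever $u,v$ have different colours, $vv'\in E(H)$ and $uv\notin E(H)$. If $p\to q$ we say that $p$ implies $q$. A *component* is a strong component of $H^+$ with more than one pair; for a set $S$ of pairs let $S'=\{(u,v):(v,u)\in S\}$ (for a component $S$, its coupled component). For a set $R$ of pairs, $R^*$ consists of $R$ and all pairs implied by a pair of $R$; the envelope $\widehat R$ is the smallest set of pairs containing $R$ and closed under implication and under transitivity ($(x,y),(y,z)\in\widehat R$ and $x\ne z$ give $(x,z)\in\widehat R$). A *circuit* in $R$ is a cyclic sequence $(x_0,x_1),(x_1,x_2),\dots,(x_n,x_0)$, $n\ge1$, of pairs of $R$. A set of pairs is *complete* if for every component $S$ it contains exactly one of $S,S'$. A component $S$ is a *dictator* if $\widehat{D_1}$ contains a circuit for every complete set $D_1\supseteq S$. A pair is *simple* if it lies in $S^*$ for some component $S$, and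 *complex* otherwise. Consider the following steps. Step 1. Reject unless $S\ne S'$ for every strong component $S$ of $H^+$. Step 2. Starting with no component selected, repeatedly select a component $S$ such that neither $S$ nor $S'$ is selected yet and the union $D$ of the sets $R^*$ over all selected components $R$, including $S$, contains no circuit; this succeeds if finally one of $S,S'$ is selected for every component $S$. Step 3. Starting from the set $D$ obtained in Step 2, repeatedly add to $D$ a pair not yet in $D$ that is implied by a pair of $D$ or obtained by transitivity from two pairs of $D$, until $\widehat D$ is reached. Every pair of $D$ carries a code $Dict(x,y)$, a component, chosen by one of these rules: (a) if $(x,y)\in S^*$ for a component $S$, then $Dict(x,y)=S$ (this is the rule used for all pairs of the initial set $D$); (b) if $x,y$ have different colours and $(x,y)$ is implied by $(u,y)$, then $Dict(x,y)=Dict(u,y)$; (c) if $x,y$ have the same colour and $(x,y)$ is implied by $(x,w)$, then $Dict(x,y)=Dict(x,w)$; (d) if $x,y$ have the same colour and $(x,y)$ is obtained by transitivity from $(x,w),(w,y)$, then $Dict(x,y)=Dict(w,y)$; (e) if $x,y$ have different colours and $(x,y)$ is obtained by transitivity from $(x,w),(w,y)$, then $Dict(x,y)=Dict(x,w)$. Whenever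 adding $(x,y)$ closes a circuit, i.e. $(x,y)$ lies on a circuit of $D\cup\{(x,y)\}$, the component $Dict(x,y)$ is put into a set $\mathcal{DT}$, which is empty at the start. **Theorem.** Suppose that Step 1 does not reject, that Step 2 succeeds with the set $D$, and that $\widehat D$ contains a circuit (that is, a circuit appears during Step 3). Then: 1. Some component $S$ selected in Step 2 is a dictator: the envelope of every complete set containing $S$ has a circuit. 2. The codes compute dictators correctly. In every run of Step 3, whatever the order in which pairs are added and whichever of the applicable rules (and of the pairs occurring in them) determine the codes, at every stage every element of $\mathcal{DT}$ is a dictator, and $Dict(x,y)$ is a dictator for every complex pair $(x,y)$ lying on a circuit of the current set. 3. When $\widehat D$ has been reached, $\mathcal{DT}$ is not empty. -/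

import Mathlib

namespace IntervalBigraph

/-! A bigraph is a graph `H` with a fixed proper 2-colouring `c : H.Coloring Bool` (black/white).
Sets of vertices of the pair-digraph are sets of ordered pairs `(u, v)` with `u ≠ v`. -/

section PairDigraph

variable {V : Type*} (H : SimpleGraph V) (c : H.Coloring Bool)

/-- The vertices of the pair-digraph `H⁺`: ordered pairs of distinct vertices of `H`. -/
def Pairs (V : Type*) : Set (V × V) := {p | p.1 ≠ p.2}

/-- The arcs of the pair-digraph `H⁺`; `Arc H c p q` reads "`p` dominates (implies) `q`".
Both ends of an arc automatically lie in `Pairs V`. -/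
inductive Arc : V × V → V × V → Prop
  | sameColor {u v u' : V} :
      c u = c v → H.Adj u u' → ¬ H.Adj v u' → Arc (u, v) (u', v)
  | diffColor {u v v' : V} :
      c u ≠ c v → H.Adj v v' → ¬ H.Adj u v → Arc (u, v) (u, v')

/-- A strong component of `H⁺` (possibly trivial). -/
def IsStrongComponent (S : Set (V × V)) : Prop :=
  ∃ p ∈ Pairs V, S = {q | q ∈ Pairs V ∧ Relation.ReflTransGen (Arc H c) p q ∧
    Relation.ReflTransGen (Arc H c) q p}

/-- A component in the short sense: a strong component with more than one pair. -/
def IsComponent (S : Set (V × V)) : Prop :=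
  IsStrongComponent H c S ∧ S.Nontrivial

/-- The coupled set `S' = {(u, v) | (v, u) ∈ S}`. -/
def coupled (S : Set (V × V)) : Set (V × V) := {p | p.swap ∈ S}

/-- The implication closure `R*`: the pairs of `R` and the pairs dominated by a pair of `R`. -/
def implClosure (R : Set (V × V)) : Set (V × V) := R ∪ {q | ∃ p ∈ R, Arc H c p q}

/-- The envelope of `R`: the smallest set of pairs that contains `R` and is closed under
implication and transitivity. -/
inductive envelope (R : Set (V × V)) : Set (V × V)
  | base {p : V × V} : p ∈ R → envelope R p
  | impl {p q : V × V} : envelope R p → Arc H c p q → envelope R q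
  | trans {x y z : V} : x ≠ z → envelope R (x, y) → envelope R (y, z) → envelope R (x, z)

/-- The cyclic sequence `(x₀,x₁), (x₁,x₂), …, (xₙ,xₙ₊₁), (xₙ₊₁,x₀)` is a circuit in `R`
(addition of indices is cyclic). -/
def IsCircuit (R : Set (V × V)) {n : ℕ} (x : Fin (n + 2) → V) : Prop :=
  ∀ i, (x i, x (i + 1)) ∈ R

/-- `R` contains a circuit. -/
def HasCircuit (R : Set (V × V)) : Prop :=
  ∃ (n : ℕ) (x : Fin (n + 2) → V), IsCircuit R x

/-- `p` is one of the pairs of some circuit in `R`. -/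
def LiesOnCircuit (R : Set (V × V)) (p : V × V) : Prop :=
  ∃ (n : ℕ) (x : Fin (n + 2) → V), IsCircuit R x ∧ ∃ i, p = (x i, x (i + 1))

/-- A set of pairs is complete if it contains exactly one of any two coupled components. -/
def IsComplete (D : Set (V × V)) : Prop :=
  D ⊆ Pairs V ∧ ∀ S, IsComponent H c S → Xor (S ⊆ D) (coupled S ⊆ D)

/-- A dictator: a component `S` such that the envelope of every complete set containing `S`
has a circuit. -/
def IsDictator (S : Set (V × V)) : Prop :=
  IsComponent H c S ∧ ∀ D, IsComplete H c D → S ⊆ D → HasCircuit (envelope H c D)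

/-- Step 1 does not reject: no strong component is self-coupled. -/
def PassesStep1 : Prop := ∀ S, IsStrongComponent H c S → coupled S ≠ S

/-- The set `D = ⋃ S*` over a family of selected components `S`. -/
def selectedPairs (sel : Set (Set (V × V))) : Set (V × V) := ⋃ S ∈ sel, implClosure H c S

/-- The families of selected components that can arise during Step 2: starting from nothing, a
component `S`, neither itself nor its coupled component being selected yet, may be selected
if this does not create a circuit in `D`. -/
inductive Step2 : Set (Set (V × V)) → Prop
  | start : Step2 ∅
  | select {sel : Set (Set (V × V))} {S : Set (V × V)} :
      Step2 sel → IsComponent H c S → S ∉ sel → coupled S ∉ sel →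
      ¬ HasCircuit (selectedPairs H c (insert S sel)) → Step2 (insert S sel)

/-- Step 2 ends successfully with the family `sel` of selected components. -/
def Step2Output (sel : Set (Set (V × V))) : Prop :=
  Step2 H c sel ∧ ∀ S, IsComponent H c S → S ∈ sel ∨ coupled S ∈ sel

/-- A pair is simple if it belongs to `S*` for some component `S`; otherwise it is complex. -/
def IsSimple (p : V × V) : Prop := ∃ S, IsComponent H c S ∧ p ∈ implClosure H c S

/-- `p` can be created from the pairs in `D` by one implication or one use of transitivity. -/
inductive CreatedFrom (D : Set (V × V)) : V × V → Prop
  | impl {p q : V × V} : p ∈ D → Arc H c p q → CreatedFrom D q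
  | trans {x y z : V} : x ≠ z → (x, y) ∈ D → (y, z) ∈ D → CreatedFrom D (x, z)

/-- The rules for the dictator code: `DictRule H c D dict p S` says that `S` is an admissible
value for `Dict p` when the current set is `D`, with codes `dict`. -/
inductive DictRule (D : Set (V × V)) (dict : V × V → Set (V × V)) :
    V × V → Set (V × V) → Prop
  | ofComponent {p : V × V} {S : Set (V × V)} :
      IsComponent H c S → p ∈ implClosure H c S → DictRule D dict p S
  | implDiff {x y u : V} : c x ≠ c y → (u, y) ∈ D → Arc H c (u, y) (x, y) →
      DictRule D dict (x, y) (dict (u, y))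
  | implSame {x y w : V} : c x = c y → (x, w) ∈ D → Arc H c (x, w) (x, y) →
      DictRule D dict (x, y) (dict (x, w))
  | transSame {x y w : V} : c x = c y → (x, w) ∈ D → (w, y) ∈ D →
      DictRule D dict (x, y) (dict (w, y))
  | transDiff {x y w : V} : c x ≠ c y → (x, w) ∈ D → (w, y) ∈ D →
      DictRule D dict (x, y) (dict (x, w))

open Classical in
/-- Runs of Step 3 from the selection `sel`. A state consists of the current set `D`, the
dictator codes `dict` (meaningful on `D`), and the set `DT` of recorded components. The pairs
created in computing the envelope are added one by one, in any order (for instance level by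
level), each with some code admitted by the rules; if adding a pair closes a circuit, its code
is recorded in `DT`. -/
inductive Step3 (sel : Set (Set (V × V))) :
    Set (V × V) → (V × V → Set (V × V)) → Set (Set (V × V)) → Prop
  | start {dict : V × V → Set (V × V)} :
      (∀ p ∈ selectedPairs H c sel, IsComponent H c (dict p) ∧ p ∈ implClosure H c (dict p)) →
      Step3 sel (selectedPairs H c sel) dict ∅
  | add {D : Set (V × V)} {dict : V × V → Set (V × V)} {DT : Set (Set (V × V))}
      {p : V × V} {S : Set (V × V)} :
      Step3 sel D dict DT → p ∉ D → CreatedFrom H c D p → DictRule H c D dict p S →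
      ¬ LiesOnCircuit (insert p D) p →
      Step3 sel (insert p D) (Function.update dict p S) DT
  | addClosing {D : Set (V × V)} {dict : V × V → Set (V × V)} {DT : Set (Set (V × V))}
      {p : V × V} {S : Set (V × V)} :
      Step3 sel D dict DT → p ∉ D → CreatedFrom H c D p → DictRule H c D dict p S →
      LiesOnCircuit (insert p D) p →
      Step3 sel (insert p D) (Function.update dict p S) (insert S DT)

end PairDigraph

end IntervalBigraph

/-! Everything rests on one fact: if the envelope of some complete set is free of circuits, then so
is the envelope of every output of Step 2 (`Step2Output.not_hasCircuit_envelope`). Contrapositively,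
under the hypotheses of the theorem the envelope of every complete set has a circuit, so every
component is a dictator. The code rules only hand components on, so every code is a dictator; and
the first circuit can only arise from adding a pair whose code is then recorded.

To prove the fact, a circuit-free envelope is turned into an orientation `Q`, an abstract "left of"
relation on nonadjacent vertices of different colours (`isOrientation_of_envelope`). Conversely an
orientation yields a strict order `endOrder` on all vertices that is preserved by arcs, so any set
of pairs inside it has a circuit-free envelope. It remains to change `Q` until it agrees with the
selected components; of these only the absence of circuits of length two and three is used.

The change is a local reversal. The vertices occurring in a component form a module-like set `U`
(`span_uniform`, `span_full_adj`), and `Q` can be reversed inside `U` if each free vertex with a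
free neighbour lies on one side of `U` (`isOrientation_reverseOn`). A disagreeing pair with the
fewest vertices between its sides has such a `U` (`exists_isReversible`). New disagreements have
strictly smaller span, so a weighted count of disagreements drops (`exists_defect_lt`). -/

namespace IntervalBigraph

open Relation

variable {V : Type*} {H : SimpleGraph V} {c : H.Coloring Bool}

/-! ### Independent pairs and abstract orientations. -/

/-- The vertices `x` and `y` lie in different edges of an induced `2K₂`. -/
def Independent (H : SimpleGraph V) (x y : V) : Prop :=
  ∃ x₁ y₁, H.Adj x x₁ ∧ H.Adj y y₁ ∧ ¬ H.Adj x y ∧ ¬ H.Adj x₁ y ∧ ¬ H.Adj x y₁ ∧ ¬ H.Adj x₁ y₁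

/-- A partial orientation of the non-adjacent pairs of different colours that behaves like the
relation "the interval of `x` lies to the left of the interval of `y`". -/
structure IsOrientation (H : SimpleGraph V) (c : H.Coloring Bool) (Q : V → V → Prop) : Prop where
  color : ∀ {x y}, Q x y → c x ≠ c y
  not_adj : ∀ {x y}, Q x y → ¬ H.Adj x y
  asymm : ∀ {x y}, Q x y → ¬ Q y x
  adj_trans : ∀ {u v w z}, Q u v → H.Adj v w → Q w z → Q u z
  trans₃ : ∀ {u v w z}, Q u v → Q v w → Q w z → Q u z
  adj_left : ∀ {x d e y}, H.Adj d x → Q d e → Q e y → ¬ H.Adj x y → Q x y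
  adj_right : ∀ {y f b x}, Q y f → Q f b → H.Adj b x → ¬ H.Adj x y → Q y x
  exchange : ∀ {u b v u'}, Q u b → H.Adj b v → H.Adj u u' → ¬ H.Adj u' v → Q u' v
  total : ∀ {x y}, Independent H x y → c x ≠ c y → Q x y ∨ Q y x

theorem color_cases (c : H.Coloring Bool) (x : V) : c x = true ∨ c x = false := by
  cases c x <;> simp

theorem Independent.symm {x y : V} (h : Independent H x y) : Independent H y x := by
  obtain ⟨x₁, y₁, h1, h2, h3, h4, h5, h6⟩ := h
  exact ⟨y₁, x₁, h2, h1, fun h => h3 h.symm, fun h => h5 h.symm, fun h => h4 h.symm,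
    fun h => h6 h.symm⟩

theorem Independent.not_adj {x y : V} (h : Independent H x y) : ¬ H.Adj x y := by
  obtain ⟨x₁, y₁, h1, h2, h3, h4, h5, h6⟩ := h
  exact h3

theorem Independent.ne {x y : V} (h : Independent H x y) : x ≠ y := by
  rintro rfl
  obtain ⟨x₁, y₁, h1, h2, h3, h4, h5, h6⟩ := h
  exact h5 h2

theorem not_adj_of_color_eq {x y : V} (h : c x = c y) : ¬ H.Adj x y := fun h' => c.valid h' h

theorem Independent.of_color_eq {x y x₁ y₁ : V} (c : H.Coloring Bool) (h : c x = c y)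
    (hx : H.Adj x x₁) (hy : H.Adj y y₁)
    (h1 : ¬ H.Adj x₁ y) (h2 : ¬ H.Adj x y₁) : Independent H x y := by
  refine ⟨x₁, y₁, hx, hy, not_adj_of_color_eq h, h1, h2, not_adj_of_color_eq (c := c) ?_⟩
  have a := c.valid hx
  have b := c.valid hy
  grind only [color_cases]

theorem Independent.of_color_ne {x y x₁ y₁ : V} (c : H.Coloring Bool) (h : c x ≠ c y)
    (hx : H.Adj x x₁) (hy : H.Adj y y₁)
    (h1 : ¬ H.Adj x y) (h2 : ¬ H.Adj x₁ y₁) : Independent H x y := by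
  have a := c.valid hx
  have b := c.valid hy
  refine ⟨x₁, y₁, hx, hy, h1, not_adj_of_color_eq (c := c) ?_, not_adj_of_color_eq (c := c) ?_, h2⟩
  · grind only [color_cases]
  · grind only [color_cases]

theorem IsOrientation.swap {Q : V → V → Prop} (hQ : IsOrientation H c Q) :
    IsOrientation H c (Function.swap Q) where
  color h := (hQ.color h).symm
  not_adj h h' := hQ.not_adj h h'.symm
  asymm h h' := hQ.asymm h h'
  adj_trans h1 h2 h3 := hQ.adj_trans h3 h2.symm h1
  trans₃ h1 h2 h3 := hQ.trans₃ h3 h2 h1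
  adj_left h1 h2 h3 h4 := hQ.adj_right h3 h2 h1 h4
  adj_right h1 h2 h3 h4 := hQ.adj_left h3 h2 h1 h4
  exchange h1 h2 h3 h4 := hQ.exchange h1 h3 h2 fun h => h4 h.symm
  total h1 h2 := (hQ.total h1 h2).symm

/-! ### The strict order generated by an orientation. -/

/-- Some interval to the right of `x` starts before the end of `y`: the partial order on all
vertices (comparing right ends) generated by an orientation. -/
def endOrder (H : SimpleGraph V) (Q : V → V → Prop) (x y : V) : Prop :=
  ∃ b, (Q x b ∨ ∃ e, Q x e ∧ Q e b) ∧ (b = y ∨ H.Adj b y)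

namespace IsOrientation

variable {Q : V → V → Prop} (hQ : IsOrientation H c Q)
include hQ

theorem endOrder_irrefl (x : V) : ¬ endOrder H Q x x := by
  rintro ⟨b, h | ⟨e, h1, h2⟩, rfl | h'⟩
  · exact hQ.color h rfl
  · exact hQ.not_adj h h'.symm
  · exact hQ.asymm h1 h2
  · have := hQ.color h1
    have := hQ.color h2
    have := c.valid h'
    grind only [color_cases]

/-- Three consecutive arrows, or two arrows joined by an edge, collapse to one arrow, so a chain
never needs more than two. -/
theorem endOrder_trans {x y z : V} (h1 : endOrder H Q x y) (h2 : endOrder H Q y z) :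
    endOrder H Q x z := by
  obtain ⟨b, hb, hb'⟩ := h1
  obtain ⟨d, hd, hd'⟩ := h2
  refine ⟨d, ?_, hd'⟩
  rcases hb' with rfl | hb'
  · rcases hb with hb | ⟨e, h1, h2⟩ <;> rcases hd with hd | ⟨e', h1', h2'⟩
    · exact Or.inr ⟨_, hb, hd⟩
    · exact Or.inl (hQ.trans₃ hb h1' h2')
    · exact Or.inl (hQ.trans₃ h1 h2 hd)
    · exact Or.inr ⟨e', hQ.trans₃ h1 h2 h1', h2'⟩
  · rcases hb with hb | ⟨e, h1, h2⟩ <;> rcases hd with hd | ⟨e', h1', h2'⟩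
    · exact Or.inl (hQ.adj_trans hb hb' hd)
    · exact Or.inr ⟨e', hQ.adj_trans hb hb' h1', h2'⟩
    · exact Or.inr ⟨e, h1, hQ.adj_trans h2 hb' hd⟩
    · exact Or.inl (hQ.trans₃ h1 (hQ.adj_trans h2 hb' h1') h2')

/-- Counting colours leaves a single arrow, or two arrows followed by an edge; the latter is an
instance of `adj_right`. -/
theorem endOrder_iff {x y : V} (hc : c x ≠ c y) (hn : ¬ H.Adj x y) :
    endOrder H Q x y ↔ Q x y := by
  refine ⟨?_, fun h => ⟨y, Or.inl h, Or.inl rfl⟩⟩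
  rintro ⟨b, h | ⟨e, h1, h2⟩, rfl | h'⟩
  · exact h
  · have := hQ.color h
    have := c.valid h'
    grind only [color_cases]
  · have := hQ.color h1
    have := hQ.color h2
    grind only [color_cases]
  · exact hQ.adj_right h1 h2 h' fun h => hn h.symm

/-- For an arc of same-coloured pairs this is what the axioms `exchange` and `adj_left` provide; an
arc of the other kind merely appends an edge to an arrow. -/
theorem endOrder_arc {p q : V × V} (h : endOrder H Q p.1 p.2) (ha : Arc H c p q) :
    endOrder H Q q.1 q.2 := by
  cases ha with
  | @sameColor u v u' huv huu hvu =>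
    obtain ⟨b, h | ⟨e, h1, h2⟩, rfl | h'⟩ := h
    · exact absurd huv (hQ.color h)
    · exact ⟨v, Or.inl (hQ.exchange h h' huu fun h => hvu h.symm), Or.inl rfl⟩
    · exact ⟨_, Or.inl (hQ.adj_left huu h1 h2 fun h => hvu h.symm), Or.inl rfl⟩
    · have := hQ.color h1
      have := hQ.color h2
      have := c.valid h'
      simp only at *
      grind only [color_cases]
  | @diffColor u v v' huv hvv hn =>
    exact ⟨v, Or.inl ((hQ.endOrder_iff huv hn).1 h), Or.inr hvv⟩

theorem endOrder_envelope {D : Set (V × V)} (hD : ∀ p ∈ D, endOrder H Q p.1 p.2) {p : V × V}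
    (hp : p ∈ envelope H c D) : endOrder H Q p.1 p.2 := by
  have hp' : envelope H c D p := hp
  clear hp
  induction hp' with
  | base h => exact hD _ h
  | impl _ ha ih => exact hQ.endOrder_arc ih ha
  | trans _ _ _ ih1 ih2 => exact hQ.endOrder_trans ih1 ih2

end IsOrientation

theorem not_hasCircuit_of_strictOrder {R : Set (V × V)} {r : V → V → Prop} (hR : ∀ p ∈ R, r p.1 p.2)
    (irrefl : ∀ x, ¬ r x x) (trans : ∀ {x y z}, r x y → r y z → r x z) : ¬ HasCircuit R := by
  rintro ⟨n, x, hx⟩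
  -- The walk stops at the last vertex `x (n + 1)`; only the final pair uses the wrap-around to `0`.
  have key : ∀ k : ℕ, k < n + 1 → r (x 0) (x (Fin.ofNat (n + 2) (k + 1))) := by
    intro k
    induction k with
    | zero =>
      intro _
      have := hR _ (hx 0)
      exact this
    | succ k ih =>
      intro hk
      have h1 := hR _ (hx (Fin.ofNat (n + 2) (k + 1)))
      have : Fin.ofNat (n + 2) (k + 1) + 1 = Fin.ofNat (n + 2) (k + 1 + 1) := by
        ext
        simp [Fin.val_add]
      rw [this] at h1
      exact trans (ih (by omega)) h1
  have h1 := key n (by omega)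
  have h2 := hR _ (hx (Fin.ofNat (n + 2) (n + 1)))
  have : Fin.ofNat (n + 2) (n + 1) + 1 = 0 := by
    ext
    simp
  rw [this] at h2
  exact irrefl _ (trans h1 h2)

theorem hasCircuit_two {R : Set (V × V)} {x y : V} (h1 : (x, y) ∈ R) (h2 : (y, x) ∈ R) :
    HasCircuit R := by
  refine ⟨0, ![x, y], fun i => ?_⟩
  fin_cases i
  · simpa using h1
  · simpa using h2

theorem hasCircuit_three {R : Set (V × V)} {x y z : V} (h1 : (x, y) ∈ R) (h2 : (y, z) ∈ R)
    (h3 : (z, x) ∈ R) : HasCircuit R := by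
  refine ⟨1, ![x, y, z], fun i => ?_⟩
  fin_cases i
  · simpa using h1
  · simpa using h2
  · simpa using h3

/-! ### From a circuit-free envelope to an orientation. -/

/-- An envelope without circuits induces an orientation. -/
theorem isOrientation_of_envelope {D : Set (V × V)} (hD : IsComplete H c D)
    (hE : ¬ HasCircuit (envelope H c D))
    (hI : ∀ {x y}, Independent H x y → ∃ S, IsComponent H c S ∧ (x, y) ∈ S) :
    IsOrientation H c fun x y => c x ≠ c y ∧ ¬ H.Adj x y ∧ (x, y) ∈ envelope H c D := by
  have two : ∀ {x y}, (x, y) ∈ envelope H c D → (y, x) ∈ envelope H c D → False :=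
    fun h1 h2 => hE (hasCircuit_two h1 h2)
  have ar : ∀ {p q}, p ∈ envelope H c D → Arc H c p q → q ∈ envelope H c D :=
    fun h1 h2 => envelope.impl h1 h2
  have tr : ∀ {x y z}, (x, y) ∈ envelope H c D → (y, z) ∈ envelope H c D → x ≠ z →
      (x, z) ∈ envelope H c D := fun h1 h2 h3 => envelope.trans h3 h1 h2
  refine ⟨fun h => h.1, fun h => h.2.1, fun h h' => two h.2.2 h'.2.2, ?_, ?_, ?_, ?_, ?_, ?_⟩
  · rintro u v w z ⟨a1, a2, a3⟩ hvw ⟨b1, b2, b3⟩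
    have hc := c.valid hvw
    have h1 := ar a3 (Arc.diffColor a1 hvw a2)
    have huz : c u ≠ c z := by grind only [color_cases]
    refine ⟨huz, fun h => ?_, tr h1 b3 fun h => huz (h ▸ rfl)⟩
    -- If `u` and `z` were adjacent, `(w, z)` would imply `(w, u)`, closing a circuit of length two
    -- with `(u, w)`.
    exact two (ar b3 (Arc.diffColor b1 h.symm b2)) h1
  · rintro u v w z ⟨a1, a2, a3⟩ ⟨b1, b2, b3⟩ ⟨d1, d2, d3⟩
    have huz : c u ≠ c z := by grind only [color_cases]
    have huw : u ≠ w := by rintro rfl; exact two a3 b3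
    have h1 := tr a3 b3 huw
    refine ⟨huz, fun h => ?_, tr h1 d3 fun h => huz (h ▸ rfl)⟩
    exact two (ar d3 (Arc.diffColor d1 h.symm d2)) h1
  · rintro x d e y hdx ⟨a1, a2, a3⟩ ⟨b1, b2, b3⟩ hxy
    have hc := c.valid hdx
    have hdy : d ≠ y := by rintro rfl; exact two a3 b3
    exact ⟨by grind only [color_cases], hxy, ar (tr a3 b3 hdy) (Arc.sameColor (by grind only [color_cases]) hdx fun h => hxy h.symm)⟩
  · rintro y f b x ⟨a1, a2, a3⟩ ⟨b1, b2, b3⟩ hbx hxy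
    have hc := c.valid hbx
    have hyx : c y ≠ c x := by grind only [color_cases]
    exact ⟨hyx, fun h => hxy h.symm,
      tr a3 (ar b3 (Arc.diffColor b1 hbx b2)) fun h => hyx (h ▸ rfl)⟩
  · rintro u b v u' ⟨a1, a2, a3⟩ hbv huu hn
    have hc := c.valid hbv
    have hc' := c.valid huu
    exact ⟨by grind only [color_cases], hn, ar (ar a3 (Arc.diffColor a1 hbv a2))
      (Arc.sameColor (by grind only [color_cases]) huu fun h => hn h.symm)⟩
  · rintro x y hxy hc
    obtain ⟨S, hS, hxyS⟩ := hI hxy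
    have : S ⊆ D ∨ coupled S ⊆ D := by
      rcases hD.2 S hS with h | h
      · exact Or.inl h.1
      · exact Or.inr h.1
    rcases this with h | h
    · exact Or.inl ⟨hc, hxy.not_adj, envelope.base (h hxyS)⟩
    · exact Or.inr ⟨hc.symm, hxy.symm.not_adj, envelope.base (h (show (y, x) ∈ coupled S from hxyS))⟩

/-! ### Reversing an orientation inside a set of vertices. -/

/-- `z` is outside `U` and has neighbours in `U`. -/
def IsFull (H : SimpleGraph V) (U : Set V) (z : V) : Prop := z ∉ U ∧ ∃ u ∈ U, H.Adj z u

/-- `z` is outside `U` and has no neighbours in `U`. -/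
def IsFree (H : SimpleGraph V) (U : Set V) (z : V) : Prop := z ∉ U ∧ ∀ u ∈ U, ¬ H.Adj u z

/-- The orientation forces the right end of `x` to precede the right end of `y`, for `x` and `y`
of different colours. -/
def endLT (H : SimpleGraph V) (Q : V → V → Prop) (x y : V) : Prop :=
  Q x y ∨ ∃ e b, Q x e ∧ Q e b ∧ H.Adj b y

/-- All of `U` is oriented towards `z`. -/
def AllBefore (c : H.Coloring Bool) (U : Set V) (Q : V → V → Prop) (z : V) : Prop :=
  ∀ u ∈ U, c u ≠ c z → Q u z

/-- Some full vertex ends before `z` does. -/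
def FullBefore (H : SimpleGraph V) (U : Set V) (Q : V → V → Prop) (z : V) : Prop :=
  ∃ f, IsFull H U f ∧ endLT H Q f z

/-- Inside `U`, some vertex ends before `u` does. -/
def InnerBefore (H : SimpleGraph V) (U : Set V) (Q : V → V → Prop) (u : V) : Prop :=
  ∃ t ∈ U, Q t u ∨ ∃ e ∈ U, ∃ b, Q t e ∧ Q e b ∧ H.Adj b u

/-- The condition for orienting `u ∈ U` towards `z ∉ U` after reversing `U`. -/
def Crossing (c : H.Coloring Bool) (U : Set V) (Q : V → V → Prop) (u z : V) : Prop :=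
  AllBefore c U Q z ∨ FullBefore H U Q z ∧ InnerBefore H U Q u

/-- The orientation obtained by reversing `Q` inside `U`. -/
def reverseOn (c : H.Coloring Bool) (U : Set V) (Q : V → V → Prop) (x y : V) : Prop :=
  (x ∈ U ∧ y ∈ U ∧ Q y x) ∨ (x ∉ U ∧ y ∉ U ∧ Q x y) ∨
  (x ∈ U ∧ IsFree H U y ∧ c x ≠ c y ∧ Crossing c U Q x y) ∨
  (y ∈ U ∧ IsFree H U x ∧ c y ≠ c x ∧ Crossing c U (Function.swap Q) y x)

/-- A set of vertices on which an orientation can be reversed. -/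
structure IsReversible (c : H.Coloring Bool) (U : Set V) (Q : V → V → Prop) : Prop where
  uniform : ∀ {z u v}, z ∉ U → u ∈ U → v ∈ U → H.Adj z u → c z ≠ c v → H.Adj z v
  full_adj : ∀ {z w}, IsFull H U z → IsFull H U w → c z ≠ c w → H.Adj z w
  exists_adj : ∀ {u}, u ∈ U → ∃ v ∈ U, H.Adj u v
  exists_arrow : ∀ k : Bool, ∃ s ∈ U, ∃ t ∈ U, c s = k ∧ Q s t
  aligned : ∀ {z w}, IsFree H U z → IsFree H U w → H.Adj z w →
    AllBefore c U Q z ∨ AllBefore c U (Function.swap Q) z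

section

variable {U : Set V} {Q : V → V → Prop}

theorem IsReversible.exists_arrow_to (hQ : IsOrientation H c Q) (hU : IsReversible c U Q) (k : Bool) :
    ∃ t ∈ U, ∃ s ∈ U, c t = k ∧ Q s t := by
  obtain ⟨s, hs, t, ht, h1, h2⟩ := hU.exists_arrow (!k)
  refine ⟨t, ht, s, hs, ?_, h2⟩
  have := hQ.color h2
  revert this h1
  cases c s <;> cases c t <;> cases k <;> simp

theorem IsReversible.swap (hQ : IsOrientation H c Q) (hU : IsReversible c U Q) :
    IsReversible c U (Function.swap Q) where
  uniform := hU.uniform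
  full_adj := hU.full_adj
  exists_adj := hU.exists_adj
  exists_arrow := hU.exists_arrow_to hQ
  aligned h1 h2 h3 := (hU.aligned h1 h2 h3).symm

theorem reverseOn_in_in {x y : V} (hx : x ∈ U) (hy : y ∈ U) : reverseOn c U Q x y ↔ Q y x := by
  simp [reverseOn, hx, hy, IsFree]

theorem reverseOn_out_out {x y : V} (hx : x ∉ U) (hy : y ∉ U) : reverseOn c U Q x y ↔ Q x y := by
  simp [reverseOn, hx, hy]

theorem reverseOn_in_out {x y : V} (hx : x ∈ U) (hy : y ∉ U) :
    reverseOn c U Q x y ↔ IsFree H U y ∧ c x ≠ c y ∧ Crossing c U Q x y := by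
  simp [reverseOn, hx, hy]

theorem reverseOn_out_in {x y : V} (hx : x ∉ U) (hy : y ∈ U) :
    reverseOn c U Q x y ↔ IsFree H U x ∧ c y ≠ c x ∧ Crossing c U (Function.swap Q) y x := by
  simp [reverseOn, hx, hy]

theorem reverseOn_swap : reverseOn c U (Function.swap Q) = Function.swap (reverseOn c U Q) := by
  funext x y
  simp only [reverseOn, Function.swap]
  apply propext
  constructor
  · rintro (h | h | h | h)
    · exact Or.inl ⟨h.2.1, h.1, h.2.2⟩
    · exact Or.inr (Or.inl ⟨h.2.1, h.1, h.2.2⟩)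
    · exact Or.inr (Or.inr (Or.inr h))
    · exact Or.inr (Or.inr (Or.inl h))
  · rintro (h | h | h | h)
    · exact Or.inl ⟨h.2.1, h.1, h.2.2⟩
    · exact Or.inr (Or.inl ⟨h.2.1, h.1, h.2.2⟩)
    · exact Or.inr (Or.inr (Or.inr h))
    · exact Or.inr (Or.inr (Or.inl h))

theorem isFull_or_isFree {z : V} (hz : z ∉ U) : IsFull H U z ∨ IsFree H U z := by
  by_cases h : IsFull H U z
  · exact Or.inl h
  · exact Or.inr ⟨hz, fun u hu hzu => h ⟨hz, u, hu, hzu.symm⟩⟩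

theorem IsFree.not_isFull {z : V} (h : IsFree H U z) : ¬ IsFull H U z :=
  fun ⟨_, u, hu, h'⟩ => h.2 u hu h'.symm

theorem isFull_of_adj {z u : V} (hz : z ∉ U) (hu : u ∈ U) (h : H.Adj u z) : IsFull H U z :=
  ⟨hz, u, hu, h.symm⟩

variable (hQ : IsOrientation H c Q) (hU : IsReversible c U Q)

theorem endLT.color (hQ : IsOrientation H c Q) {x y : V} (h : endLT H Q x y) : c x ≠ c y := by
  rcases h with h | ⟨e, b, h1, h2, h3⟩
  · exact hQ.color h
  · have := hQ.color h1
    have := hQ.color h2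
    have := c.valid h3
    grind only [color_cases]

theorem FullBefore.of_arrow {f y : V} (hf : IsFull H U f) (h : Q f y) : FullBefore H U Q y :=
  ⟨f, hf, Or.inl h⟩

namespace IsReversible

include hU in
theorem adj_of_isFull {f u : V} (hf : IsFull H U f) (hu : u ∈ U) (h : c f ≠ c u) : H.Adj f u := by
  obtain ⟨hf, v, hv, hfv⟩ := hf
  exact hU.uniform hf hv hu hfv h

include hU in
theorem isFree_of_not_adj {z u : V} (hz : z ∉ U) (hu : u ∈ U) (h : c u ≠ c z) (hn : ¬ H.Adj u z) :
    IsFree H U z :=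
  ⟨hz, fun _ hv hvz => hn (hU.uniform hz hv hu hvz.symm h.symm).symm⟩

include hQ hU

theorem isFree_of_arrow {f y : V} (hf : IsFull H U f) (h : Q f y) : IsFree H U y := by
  have hy : y ∉ U := fun hy => hQ.not_adj h (hU.adj_of_isFull hf hy (hQ.color h))
  rcases isFull_or_isFree hy with hy | hy
  · exact absurd (hU.full_adj hf hy (hQ.color h)) (hQ.not_adj h)
  · exact hy

omit hQ in
theorem exists_adj_color {u : V} (hu : u ∈ U) : ∃ v ∈ U, H.Adj u v ∧ c u ≠ c v := by
  obtain ⟨v, hv, h⟩ := hU.exists_adj hu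
  exact ⟨v, hv, h, c.valid h⟩

omit hQ in
theorem exists_arrow_ne (z : V) : ∃ s ∈ U, ∃ t ∈ U, c s ≠ c z ∧ Q s t := by
  obtain ⟨s, hs, t, ht, h, h'⟩ := hU.exists_arrow (!(c z))
  exact ⟨s, hs, t, ht, by simp [h], h'⟩

/-- If `u` ends before some `t ∈ U` starts, `t` meets the full vertex `f`, and `f` ends before `z`,
then `u` is left of `z`. The same argument after reversal explains the second alternative of
`Crossing`: those arrows are forced. -/
theorem arrow_of_fullBefore {u z : V} (hu : u ∈ U) (hz : IsFree H U z) (hc : c u ≠ c z)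
    (hK : FullBefore H U Q z) (hJ : InnerBefore H U (Function.swap Q) u) : Q u z := by
  have step : ∀ {f y}, IsFull H U f → Q f y → c u ≠ c y → Q u y := by
    intro f y hf hfy hcu
    have hy := hU.isFree_of_arrow hQ hf hfy
    have h0 := hQ.color hfy
    obtain ⟨t, ht, h | ⟨e, he, b, h1, h2, h3⟩⟩ := hJ
    · have := hQ.color h
      exact hQ.adj_trans h (hU.adj_of_isFull hf ht (by grind only [color_cases])).symm hfy
    · have := hQ.color h1
      have := hQ.color h2
      have := c.valid h3
      have h4 : Q e y :=
        hQ.adj_trans h1 (hU.adj_of_isFull hf ht (by grind only [color_cases])).symm hfy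
      exact hQ.adj_left h3 h2 h4 (hy.2 u hu)
  obtain ⟨f, hf, h | ⟨e, b, h1, h2, h3⟩⟩ := hK
  · exact step hf h hc
  · have := hQ.color h1
    have := hQ.color h2
    have := c.valid h3
    exact hQ.adj_right (step hf h1 (by grind only [color_cases])) h2 h3
      fun h => hz.2 u hu h.symm

/-- A full vertex ending before `z` would, via `z` and an arrow from `s` to `t` inside `U`, be left
of `t`, to which it is adjacent. -/
theorem not_fullBefore {z : V} (hW : AllBefore c U (Function.swap Q) z) : ¬ FullBefore H U Q z := by
  rintro ⟨f, hf, h⟩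
  obtain ⟨s, hs, t, ht, h1, h2⟩ := hU.exists_arrow_ne z
  have h3 := h.color hQ
  have h4 := hQ.color h2
  have hft : ¬ Q f t := fun h => hQ.not_adj h (hU.adj_of_isFull hf ht (by grind only [color_cases]))
  have hzs : Q z s := hW s hs h1
  rcases h with h | ⟨e, b, h5, h6, h7⟩
  · exact hft (hQ.trans₃ h hzs h2)
  · exact hft (hQ.trans₃ h5 (hQ.adj_trans h6 h7 hzs) h2)

theorem not_allBefore {z : V} (hW : AllBefore c U (Function.swap Q) z) : ¬ AllBefore c U Q z := by
  intro h
  obtain ⟨s, hs, t, ht, h1, h2⟩ := hU.exists_arrow_ne z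
  exact hQ.asymm (hW s hs h1) (h s hs h1)

omit hU in
theorem fullBefore_adj {z p z' : V} (hK : FullBefore H U Q z) (h : Q z p) (h' : H.Adj p z') :
    FullBefore H U Q z' := by
  obtain ⟨f, hf, h0 | ⟨e, b, h1, h2, h3⟩⟩ := hK
  · exact ⟨f, hf, Or.inr ⟨z, p, h0, h, h'⟩⟩
  · exact ⟨f, hf, Or.inr ⟨e, p, h1, hQ.adj_trans h2 h3 h, h'⟩⟩

omit hU in
theorem exists_full_arrow {z p z' : V} (hK : FullBefore H U Q z) (h : Q z p) (h' : Q p z') :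
    ∃ f, IsFull H U f ∧ Q f z' := by
  obtain ⟨f, hf, h0 | ⟨e, b, h1, h2, h3⟩⟩ := hK
  · exact ⟨f, hf, hQ.trans₃ h0 h h'⟩
  · exact ⟨f, hf, hQ.trans₃ h1 (hQ.adj_trans h2 h3 h) h'⟩

theorem allBefore_isFree {z : V} (hz : z ∉ U) (hW : AllBefore c U Q z) : IsFree H U z := by
  obtain ⟨s, hs, t, ht, h1, h2⟩ := hU.exists_arrow_ne z
  exact hU.isFree_of_not_adj hz hs h1 (hQ.not_adj (hW s hs h1))

theorem allBefore_of_allBefore {z w : V} (hW : AllBefore c U Q z) (h : Q z w) :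
    AllBefore c U Q w ∧ IsFree H U w := by
  have hcw := hQ.color h
  have hw : w ∉ U := fun hw => hQ.asymm h (hW w hw hcw.symm)
  have hw' : IsFree H U w := by
    rcases isFull_or_isFree hw with hw | hw
    · obtain ⟨s, hs, t, ht, h1, h2⟩ := hU.exists_arrow_to hQ (c w)
      have h3 := hQ.color h2
      have h4 := hQ.trans₃ h2 (hW s hs (by grind only)) h
      exact absurd (hU.adj_of_isFull hw ht (by grind only)).symm (hQ.not_adj h4)
    · exact hw
  refine ⟨fun u hu huw => ?_, hw'⟩
  obtain ⟨v, hv, huv, hc⟩ := hU.exists_adj_color hu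
  exact hQ.adj_left huv.symm (hW v hv (by grind only [color_cases])) h (hw'.2 u hu)

theorem allBefore_of_fullBefore {z w : V} (hK : FullBefore H U Q z) (h : Q z w)
    (hw : IsFree H U w) : AllBefore c U Q w := by
  intro u hu huw
  have h0 := hQ.color h
  obtain ⟨f, hf, h1⟩ := hK
  have h2 := h1.color hQ
  have hfu := hU.adj_of_isFull hf hu (by grind only [color_cases])
  rcases h1 with h1 | ⟨e, b, h3, h4, h5⟩
  · exact hQ.adj_left hfu h1 h (hw.2 u hu)
  · exact hQ.adj_left hfu h3 (hQ.adj_trans h4 h5 h) (hw.2 u hu)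

/-- Adjacent free vertices cannot be on opposite sides of `U`, since passing through an edge of `U`
would put an arrow on their edge. -/
theorem allBefore_of_adj {z w : V} (hz : IsFree H U z) (hw : IsFree H U w) (h : H.Adj z w)
    (h' : AllBefore c U Q z ∨ FullBefore H U Q z) : AllBefore c U Q z ∧ AllBefore c U Q w := by
  have hWz : AllBefore c U Q z := by
    rcases hU.aligned hz hw h with h1 | h1
    · exact h1
    · rcases h' with h' | h'
      · exact h'
      · exact absurd h' (hU.not_fullBefore hQ h1)
  refine ⟨hWz, ?_⟩
  rcases hU.aligned hw hz h.symm with h1 | h1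
  · exact h1
  · obtain ⟨s, hs, t, ht, h2, h3⟩ := hU.exists_arrow_ne z
    obtain ⟨v, hv, hsv, h4⟩ := hU.exists_adj_color hs
    have h5 := c.valid h
    exact absurd h.symm
      (hQ.not_adj (hQ.adj_trans (h1 v hv (by grind only [color_cases])) hsv.symm (hWz s hs h2)))

theorem arrow_of_allBefore_fullBefore {z w : V} (hw : IsFree H U w)
    (hc : c z ≠ c w) (h1 : AllBefore c U (Function.swap Q) z)
    (h2 : AllBefore c U Q w ∨ FullBefore H U Q w) : Q z w := by
  obtain ⟨s, hs, t, ht, h3, h4⟩ := hU.exists_arrow_ne w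
  obtain ⟨v, hv, hsv, h5⟩ := hU.exists_adj_color hs
  have h6 : Q s w := by
    rcases h2 with h2 | h2
    · exact h2 s hs h3
    · exact hU.arrow_of_fullBefore hQ hs hw h3 h2 ⟨t, ht, Or.inl h4⟩
  exact hQ.adj_trans (h1 v hv (by grind only [color_cases])) hsv.symm h6

/-- The set `U` separates `z` from `w`. If one of them has all of `U` on one side, an edge inside
`U` links the arrows; otherwise the link is the edge between the full vertices `g`, to the right of
`z`, and `f`, to the left of `w`. -/
theorem arrow_of_free {z w : V} (hz : IsFree H U z) (hw : IsFree H U w) (hc : c z ≠ c w)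
    (h1 : AllBefore c U (Function.swap Q) z ∨ FullBefore H U (Function.swap Q) z)
    (h2 : AllBefore c U Q w ∨ FullBefore H U Q w) : Q z w := by
  have hn : ¬ H.Adj z w := by
    intro h
    have h3 := (hU.swap hQ).allBefore_of_adj hQ.swap hz hw h h1
    have h4 := hU.allBefore_of_adj hQ hw hz h.symm h2
    exact hU.not_allBefore hQ h3.1 h4.2
  rcases h1 with h1 | h1
  · exact hU.arrow_of_allBefore_fullBefore hQ hw hc h1 h2
  rcases h2 with h2 | h2
  · exact (hU.swap hQ).arrow_of_allBefore_fullBefore hQ.swap hz hc.symm h2 (Or.inr h1)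
  obtain ⟨g, hg, h1⟩ := h1
  obtain ⟨f, hf, h2⟩ := h2
  have h3 := h1.color hQ.swap
  have h4 := h2.color hQ
  have hgf : H.Adj g f := hU.full_adj hg hf (by grind only [color_cases])
  rcases h1 with h1 | ⟨e, b, h5, h6, h7⟩ <;> rcases h2 with h2 | ⟨e', b', h5', h6', h7'⟩
  · exact hQ.adj_trans h1 hgf h2
  · exact hQ.adj_right (hQ.adj_trans h1 hgf h5') h6' h7' fun h => hn h.symm
  · exact hQ.adj_left h7 h6 (hQ.adj_trans h5 hgf h2) hn
  · exact hQ.exchange (hQ.trans₃ h6 (hQ.adj_trans h5 hgf h5') h6') h7' h7 hn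

end IsReversible

end

/-! ### The reversed relation satisfies the axioms of an orientation. -/

section

variable {U : Set V} {Q : V → V → Prop}
variable (hQ : IsOrientation H c Q) (hU : IsReversible c U Q)

theorem Crossing.weaken {u z : V} (h : Crossing c U Q u z) :
    AllBefore c U Q z ∨ FullBefore H U Q z := h.imp_right And.left

include hQ in
theorem reverseOn_color {x y : V} (h : reverseOn c U Q x y) : c x ≠ c y := by
  rcases h with h | h | h | h
  · exact (hQ.color h.2.2).symm
  · exact hQ.color h.2.2
  · exact h.2.2.1
  · exact h.2.2.1.symm

include hQ in
theorem reverseOn_not_adj {x y : V} (h : reverseOn c U Q x y) : ¬ H.Adj x y := by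
  rcases h with h | h | h | h
  · exact fun h' => hQ.not_adj h.2.2 h'.symm
  · exact hQ.not_adj h.2.2
  · exact h.2.1.2 x h.1
  · exact fun h' => h.2.1.2 y h.1 h'.symm

namespace IsReversible

include hQ hU

/-- An `AllBefore` alternative in one direction excludes both alternatives in the other, so only
full vertices on both sides remain possible. -/
theorem crossing_swap {u v z : V} (h1 : Crossing c U Q u z)
    (h2 : Crossing c U (Function.swap Q) v z) :
    (FullBefore H U Q z ∧ InnerBefore H U Q u) ∧
      FullBefore H U (Function.swap Q) z ∧ InnerBefore H U (Function.swap Q) v := by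
  rcases h1 with h1 | h1 <;> rcases h2 with h2 | h2
  · exact absurd h1 (hU.not_allBefore hQ h2)
  · exact absurd h2.1 ((hU.swap hQ).not_fullBefore hQ.swap h1)
  · exact absurd h1.1 (hU.not_fullBefore hQ h2)
  · exact ⟨h1, h2⟩

/-- Combining the full vertex of each crossing with the inner vertex of the opposite one gives
arrows of `Q` in both directions. -/
theorem reverseOn_asymm_of_mem {x y : V} (hx : x ∈ U) (hy : y ∉ U) (h1 : reverseOn c U Q x y)
    (h2 : reverseOn c U Q y x) : False := by
  obtain ⟨h3, h4, h5⟩ := (reverseOn_in_out hx hy).1 h1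
  obtain ⟨-, -, h6⟩ := (reverseOn_out_in hy hx).1 h2
  obtain ⟨⟨h7, h8⟩, h9, h10⟩ := hU.crossing_swap hQ h5 h6
  exact hQ.asymm (hU.arrow_of_fullBefore hQ hx h3 h4 h7 h10)
    ((hU.swap hQ).arrow_of_fullBefore hQ.swap hx h3 h4 h9 h8)

theorem reverseOn_asymm {x y : V} (h1 : reverseOn c U Q x y) : ¬ reverseOn c U Q y x := by
  intro h2
  by_cases hx : x ∈ U <;> by_cases hy : y ∈ U
  · exact hQ.asymm ((reverseOn_in_in hx hy).1 h1) ((reverseOn_in_in hy hx).1 h2)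
  · exact hU.reverseOn_asymm_of_mem hQ hx hy h1 h2
  · exact hU.reverseOn_asymm_of_mem hQ hy hx h2 h1
  · exact hQ.asymm ((reverseOn_out_out hx hy).1 h1) ((reverseOn_out_out hy hx).1 h2)

omit hQ in
-- The partner `y₁` of `y` in the `2K₂` is free: if full, it would be adjacent to `x₁`, whether `x₁`
-- lies in `U` or is itself full. Hence `aligned` applies to the edge `y y₁`.
theorem allBefore_or_of_independent {x y : V} (hx : x ∈ U) (hy : y ∉ U) (h : Independent H x y)
    (hc : c x ≠ c y) :
    IsFree H U y ∧ (AllBefore c U Q y ∨ AllBefore c U (Function.swap Q) y) := by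
  have hfy := hU.isFree_of_not_adj hy hx hc h.not_adj
  obtain ⟨x₁, y₁, h1, h2, h3, h4, h5, h6⟩ := h
  have c1 := c.valid h1
  have c2 := c.valid h2
  have c3 : c y₁ ≠ c x₁ := by grind only [color_cases]
  have hy₁ : y₁ ∉ U := fun h => hfy.2 y₁ h h2.symm
  refine ⟨hfy, hU.aligned hfy ((isFull_or_isFree hy₁).resolve_left fun h => ?_) h2⟩
  by_cases hx₁ : x₁ ∈ U
  · exact h6 (hU.adj_of_isFull h hx₁ c3).symm
  · exact h6 (hU.full_adj h (isFull_of_adj hx₁ hx h1) c3).symm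

omit hQ in
theorem reverseOn_total_of_mem {x y : V} (hx : x ∈ U) (hy : y ∉ U) (h : Independent H x y)
    (hc : c x ≠ c y) : reverseOn c U Q x y ∨ reverseOn c U Q y x := by
  rw [reverseOn_in_out hx hy, reverseOn_out_in hy hx]
  obtain ⟨hfy, h | h⟩ := hU.allBefore_or_of_independent hx hy h hc
  · exact Or.inl ⟨hfy, hc, Or.inl h⟩
  · exact Or.inr ⟨hfy, hc, Or.inl h⟩

theorem arrow_of_reverseOn_of_mem {x y : V} (hx : x ∈ U) (hy : y ∉ U) (h : Independent H x y)
    (h1 : reverseOn c U Q x y) : Q x y := by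
  have hc := reverseOn_color hQ h1
  obtain ⟨hfy, h2 | h2⟩ := hU.allBefore_or_of_independent hx hy h hc
  · exact h2 x hx hc
  · exact absurd h1 (hU.reverseOn_asymm hQ ((reverseOn_out_in hy hx).2 ⟨hfy, hc, Or.inl h2⟩))

/-- This makes the reversal local: among independent pairs, only those inside `U` change direction.
-/
theorem arrow_of_reverseOn {x y : V} (h : Independent H x y) (hxy : ¬ (x ∈ U ∧ y ∈ U))
    (h1 : reverseOn c U Q x y) : Q x y := by
  by_cases hx : x ∈ U <;> by_cases hy : y ∈ U
  · exact absurd ⟨hx, hy⟩ hxy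
  · exact hU.arrow_of_reverseOn_of_mem hQ hx hy h h1
  · have := (hU.swap hQ).arrow_of_reverseOn_of_mem hQ.swap hy hx h.symm
    simp only [reverseOn_swap, Function.swap] at this
    exact this h1
  · exact (reverseOn_out_out hx hy).1 h1

theorem reverseOn_total {x y : V} (h : Independent H x y) (hc : c x ≠ c y) :
    reverseOn c U Q x y ∨ reverseOn c U Q y x := by
  by_cases hx : x ∈ U <;> by_cases hy : y ∈ U
  · rw [reverseOn_in_in hx hy, reverseOn_in_in hy hx]
    exact (hQ.total h hc).symm
  · exact hU.reverseOn_total_of_mem hx hy h hc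
  · exact (hU.reverseOn_total_of_mem hy hx h.symm hc.symm).symm
  · rw [reverseOn_out_out hx hy, reverseOn_out_out hy hx]
    exact hQ.total h hc

theorem reverseOn_adj_trans_of_mem {u v w z : V} (hu : u ∈ U) (h1 : reverseOn c U Q u v)
    (h2 : H.Adj v w) (h3 : reverseOn c U Q w z) : reverseOn c U Q u z := by
  have c1 := reverseOn_color hQ h1
  have c2 := c.valid h2
  have c3 := reverseOn_color hQ h3
  have c4 : c u ≠ c z := by grind only [color_cases]
  by_cases hv : v ∈ U
  · rw [reverseOn_in_in hu hv] at h1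
    by_cases hw : w ∈ U
    · by_cases hz : z ∈ U
      · rw [reverseOn_in_in hw hz] at h3
        rw [reverseOn_in_in hu hz]
        exact hQ.adj_trans h3 h2.symm h1
      · rw [reverseOn_in_out hw hz] at h3
        rw [reverseOn_in_out hu hz]
        exact ⟨h3.1, c4, h3.2.2.imp_right fun h => ⟨h.1, v, hv, Or.inl h1⟩⟩
    · have hfw := isFull_of_adj hw hv h2
      by_cases hz : z ∈ U
      · exact absurd hfw ((reverseOn_out_in hw hz).1 h3).1.not_isFull
      · rw [reverseOn_out_out hw hz] at h3
        rw [reverseOn_in_out hu hz]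
        exact ⟨hU.isFree_of_arrow hQ hfw h3, c4, Or.inr ⟨.of_arrow hfw h3, v, hv, Or.inl h1⟩⟩
  · rw [reverseOn_in_out hu hv] at h1
    obtain ⟨hfv, -, h1⟩ := h1
    by_cases hw : w ∈ U
    · exact absurd h2.symm (hfv.2 w hw)
    · rcases isFull_or_isFree hw with hfw | hfw
      · by_cases hz : z ∈ U
        · exact absurd hfw ((reverseOn_out_in hw hz).1 h3).1.not_isFull
        · rw [reverseOn_out_out hw hz] at h3
          rw [reverseOn_in_out hu hz]
          have hfz := hU.isFree_of_arrow hQ hfw h3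
          exact ⟨hfz, c4, h1.elim
            (fun h => Or.inl fun t ht hc => hQ.adj_trans (h t ht (by grind only [color_cases])) h2 h3)
            (fun h => Or.inr ⟨.of_arrow hfw h3, h.2⟩)⟩
      · have h4 := hU.allBefore_of_adj hQ hfv hfw h2 h1.weaken
        by_cases hz : z ∈ U
        · exfalso
          obtain ⟨-, -, h5⟩ := (reverseOn_out_in hw hz).1 h3
          exact hU.not_allBefore hQ
            ((hU.swap hQ).allBefore_of_adj hQ.swap hfw hfv h2.symm h5.weaken).1 h4.2
        · rw [reverseOn_out_out hw hz] at h3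
          rw [reverseOn_in_out hu hz]
          have hWz : AllBefore c U Q z := fun t ht hc =>
            hQ.adj_trans (h4.1 t ht (by grind only [color_cases])) h2 h3
          exact ⟨hU.allBefore_isFree hQ hz hWz, c4, Or.inl hWz⟩

theorem reverseOn_adj_trans_of_notMem {u v w z : V} (hu : u ∉ U) (hv : v ∈ U) (hz : z ∉ U)
    (h1 : reverseOn c U Q u v)
    (h2 : H.Adj v w) (h3 : reverseOn c U Q w z) : reverseOn c U Q u z := by
  have c1 := reverseOn_color hQ h1
  have c2 := c.valid h2
  have c3 := reverseOn_color hQ h3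
  have c4 : c u ≠ c z := by grind only [color_cases]
  rw [reverseOn_out_in hu hv] at h1
  rw [reverseOn_out_out hu hz]
  by_cases hw : w ∈ U
  · rw [reverseOn_in_out hw hz] at h3
    exact hU.arrow_of_free hQ h1.1 h3.1 c4 h1.2.2.weaken h3.2.2.weaken
  · have hfw := isFull_of_adj hw hv h2
    rw [reverseOn_out_out hw hz] at h3
    exact hU.arrow_of_free hQ h1.1 (hU.isFree_of_arrow hQ hfw h3) c4 h1.2.2.weaken
      (Or.inr (.of_arrow hfw h3))

/-- Mirror symmetry exchanges the two ends of the chain, leaving chains that start in `U` and chains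
that pass through `U` between outside vertices. -/
theorem reverseOn_adj_trans {u v w z : V} (h1 : reverseOn c U Q u v)
    (h2 : H.Adj v w) (h3 : reverseOn c U Q w z) : reverseOn c U Q u z := by
  by_cases hu : u ∈ U
  · exact hU.reverseOn_adj_trans_of_mem hQ hu h1 h2 h3
  by_cases hz : z ∈ U
  · have := (hU.swap hQ).reverseOn_adj_trans_of_mem hQ.swap (u := z) (v := w) (w := v) (z := u) hz
    simp only [reverseOn_swap, Function.swap] at this
    exact this h3 h2.symm h1
  by_cases hv : v ∈ U
  · exact hU.reverseOn_adj_trans_of_notMem hQ hu hv hz h1 h2 h3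
  by_cases hw : w ∈ U
  · have := (hU.swap hQ).reverseOn_adj_trans_of_notMem hQ.swap (u := z) (v := w) (w := v) (z := u)
      hz hw hu
    simp only [reverseOn_swap, Function.swap] at this
    exact this h3 h2.symm h1
  · rw [reverseOn_out_out hu hv] at h1
    rw [reverseOn_out_out hw hz] at h3
    rw [reverseOn_out_out hu hz]
    exact hQ.adj_trans h1 h2 h3

/-- Some `t ∈ U` ends before `v`, and the chain from `t` through `v` and `w` collapses to an arrow
into `z`; a full `z` would be adjacent to `t`. -/
theorem not_arrow_full {u v w z : V} (hu : u ∈ U) (hv : v ∈ U) (hvu : Q v u) (hw : IsFree H U w)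
    (hvw : c v ≠ c w) (hK : FullBefore H U Q w) (hJ : InnerBefore H U Q v) (hwz : Q w z) :
    ¬ IsFull H U z := by
  intro hz
  have h1 : Q v w := hU.arrow_of_fullBefore hQ hv hw hvw hK ⟨u, hu, Or.inl hvu⟩
  have c1 := hQ.color hwz
  obtain ⟨t, ht, h2 | ⟨e, he, b, h2, h3, h4⟩⟩ := hJ
  · have h5 := hQ.trans₃ h2 h1 hwz
    exact hQ.not_adj h5 (hU.adj_of_isFull hz ht (hQ.color h5).symm).symm
  · have h5 := hQ.trans₃ h2 (hQ.adj_trans h3 h4 h1) hwz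
    exact hQ.not_adj h5 (hU.adj_of_isFull hz ht (hQ.color h5).symm).symm

theorem reverseOn_trans₃_of_mem {u v w z : V} (hu : u ∈ U) (h1 : reverseOn c U Q u v)
    (h2 : reverseOn c U Q v w) (h3 : reverseOn c U Q w z) : reverseOn c U Q u z := by
  have c1 := reverseOn_color hQ h1
  have c2 := reverseOn_color hQ h2
  have c3 := reverseOn_color hQ h3
  have c4 : c u ≠ c z := by grind only [color_cases]
  by_cases hv : v ∈ U
  · rw [reverseOn_in_in hu hv] at h1
    by_cases hw : w ∈ U
    · rw [reverseOn_in_in hv hw] at h2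
      by_cases hz : z ∈ U
      · rw [reverseOn_in_in hw hz] at h3
        rw [reverseOn_in_in hu hz]
        exact hQ.trans₃ h3 h2 h1
      · rw [reverseOn_in_out hw hz] at h3
        rw [reverseOn_in_out hu hz]
        exact ⟨h3.1, c4, h3.2.2.imp_right fun h => ⟨h.1, v, hv, Or.inl h1⟩⟩
    · obtain ⟨hfw, -, h2⟩ := (reverseOn_in_out hv hw).1 h2
      by_cases hz : z ∈ U
      · exfalso
        obtain ⟨-, -, h3⟩ := (reverseOn_out_in hw hz).1 h3
        obtain ⟨⟨h4, h5⟩, h6, h7⟩ := hU.crossing_swap hQ h2 h3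
        exact hQ.asymm (hU.arrow_of_fullBefore hQ hv hfw c2 h4 ⟨u, hu, Or.inl h1⟩)
          ((hU.swap hQ).arrow_of_fullBefore hQ.swap hv hfw c2 h6 h5)
      · rw [reverseOn_out_out hw hz] at h3
        rw [reverseOn_in_out hu hz]
        rcases h2 with h2 | h2
        · obtain ⟨h4, h5⟩ := hU.allBefore_of_allBefore hQ h2 h3
          exact ⟨h5, c4, Or.inl h4⟩
        · have hfz := (isFull_or_isFree hz).resolve_left
            (hU.not_arrow_full hQ hu hv h1 hfw c2 h2.1 h2.2 h3)
          exact ⟨hfz, c4, Or.inl (hU.allBefore_of_fullBefore hQ h2.1 h3 hfz)⟩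
  · obtain ⟨hfv, -, h1⟩ := (reverseOn_in_out hu hv).1 h1
    by_cases hw : w ∈ U
    · obtain ⟨-, c5, h2⟩ := (reverseOn_out_in hv hw).1 h2
      obtain ⟨⟨h4, h5⟩, h6, h7⟩ := hU.crossing_swap hQ h1 h2
      by_cases hz : z ∈ U
      · rw [reverseOn_in_in hw hz] at h3
        exact absurd (hU.arrow_of_fullBefore hQ hw hfv c5 h4 h7)
          (hQ.asymm ((hU.swap hQ).arrow_of_fullBefore hQ.swap hw hfv c5 h6 ⟨z, hz, Or.inl h3⟩))
      · rw [reverseOn_in_out hw hz] at h3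
        rw [reverseOn_in_out hu hz]
        exact ⟨h3.1, c4, h3.2.2.imp_right fun h => ⟨h.1, h5⟩⟩
    · rw [reverseOn_out_out hv hw] at h2
      by_cases hz : z ∈ U
      · exfalso
        obtain ⟨hfw, -, h3⟩ := (reverseOn_out_in hw hz).1 h3
        have hWw : AllBefore c U Q w := by
          rcases h1 with h1 | h1
          · exact (hU.allBefore_of_allBefore hQ h1 h2).1
          · exact hU.allBefore_of_fullBefore hQ h1.1 h2 hfw
        rcases h3 with h3 | h3
        · exact hU.not_allBefore hQ h3 hWw
        · exact (hU.swap hQ).not_fullBefore hQ.swap hWw h3.1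
      · rw [reverseOn_out_out hw hz] at h3
        rw [reverseOn_in_out hu hz]
        rcases h1 with h1 | h1
        · have h4 := hU.allBefore_of_allBefore hQ (hU.allBefore_of_allBefore hQ h1 h2).1 h3
          exact ⟨h4.2, c4, Or.inl h4.1⟩
        · obtain ⟨f, hf, h4⟩ := exists_full_arrow hQ h1.1 h2 h3
          exact ⟨hU.isFree_of_arrow hQ hf h4, c4, Or.inr ⟨.of_arrow hf h4, h1.2⟩⟩

theorem reverseOn_trans₃_of_notMem {u v w z : V} (hu : u ∉ U) (hv : v ∈ U) (hz : z ∉ U)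
    (h1 : reverseOn c U Q u v)
    (h2 : reverseOn c U Q v w) (h3 : reverseOn c U Q w z) : reverseOn c U Q u z := by
  have c1 := reverseOn_color hQ h1
  have c2 := reverseOn_color hQ h2
  have c3 := reverseOn_color hQ h3
  have c4 : c u ≠ c z := by grind only [color_cases]
  obtain ⟨hfu, -, h1⟩ := (reverseOn_out_in hu hv).1 h1
  rw [reverseOn_out_out hu hz]
  by_cases hw : w ∈ U
  · rw [reverseOn_in_out hw hz] at h3
    exact hU.arrow_of_free hQ hfu h3.1 c4 h1.weaken h3.2.2.weaken
  · obtain ⟨hfw, -, h2⟩ := (reverseOn_in_out hv hw).1 h2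
    rw [reverseOn_out_out hw hz] at h3
    rcases h2 with h2 | h2
    · have h4 := hU.allBefore_of_allBefore hQ h2 h3
      exact hU.arrow_of_free hQ hfu h4.2 c4 h1.weaken (Or.inl h4.1)
    · rcases isFull_or_isFree hz with hfz | hfz
      · rcases h1 with h1 | h1
        · obtain ⟨s, hs, t, ht, h4, h5⟩ := hU.exists_arrow_ne w
          exact hQ.trans₃ (h1 s hs (by grind only [color_cases]))
            (hU.arrow_of_fullBefore hQ hs hfw h4 h2.1 ⟨t, ht, Or.inl h5⟩) h3
        · exact hQ.trans₃ ((hU.swap hQ).arrow_of_fullBefore hQ.swap hv hfu c1.symm h1.1 h2.2)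
            (hU.arrow_of_fullBefore hQ hv hfw c2 h2.1 h1.2) h3
      · exact hU.arrow_of_free hQ hfu hfz c4 h1.weaken
          (Or.inl (hU.allBefore_of_fullBefore hQ h2.1 h3 hfz))

theorem reverseOn_trans₃ {u v w z : V} (h1 : reverseOn c U Q u v)
    (h2 : reverseOn c U Q v w) (h3 : reverseOn c U Q w z) : reverseOn c U Q u z := by
  by_cases hu : u ∈ U
  · exact hU.reverseOn_trans₃_of_mem hQ hu h1 h2 h3
  by_cases hz : z ∈ U
  · have := (hU.swap hQ).reverseOn_trans₃_of_mem hQ.swap (u := z) (v := w) (w := v) (z := u) hz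
    simp only [reverseOn_swap, Function.swap] at this
    exact this h3 h2 h1
  by_cases hv : v ∈ U
  · exact hU.reverseOn_trans₃_of_notMem hQ hu hv hz h1 h2 h3
  by_cases hw : w ∈ U
  · have := (hU.swap hQ).reverseOn_trans₃_of_notMem hQ.swap (u := z) (v := w) (w := v) (z := u)
      hz hw hu
    simp only [reverseOn_swap, Function.swap] at this
    exact this h3 h2 h1
  · rw [reverseOn_out_out hu hv] at h1
    rw [reverseOn_out_out hv hw] at h2
    rw [reverseOn_out_out hw hz] at h3
    rw [reverseOn_out_out hu hz]
    exact hQ.trans₃ h1 h2 h3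

theorem reverseOn_adj_left_of_mem {x d e y : V} (hx : x ∈ U) (h0 : H.Adj d x)
    (h1 : reverseOn c U Q d e) (h2 : reverseOn c U Q e y) (hn : ¬ H.Adj x y) :
    reverseOn c U Q x y := by
  have c0 := c.valid h0
  have c1 := reverseOn_color hQ h1
  have c2 := reverseOn_color hQ h2
  have c3 : c x ≠ c y := by grind only [color_cases]
  by_cases hd : d ∈ U
  · by_cases he : e ∈ U
    · rw [reverseOn_in_in hd he] at h1
      by_cases hy : y ∈ U
      · rw [reverseOn_in_in he hy] at h2
        rw [reverseOn_in_in hx hy]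
        exact hQ.adj_right h2 h1 h0 hn
      · rw [reverseOn_in_out he hy] at h2
        rw [reverseOn_in_out hx hy]
        refine ⟨h2.1, c3, h2.2.2.imp_right fun h => ⟨h.1, ?_⟩⟩
        obtain ⟨-, t, ht, h3 | ⟨g, hg, b, h3, h4, h5⟩⟩ := h
        · exact ⟨t, ht, Or.inr ⟨e, he, d, h3, h1, h0⟩⟩
        · exact ⟨t, ht, Or.inr ⟨g, hg, d, h3, hQ.adj_trans h4 h5 h1, h0⟩⟩
    · obtain ⟨hfe, -, h1⟩ := (reverseOn_in_out hd he).1 h1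
      by_cases hy : y ∈ U
      · obtain ⟨-, c5, h2⟩ := (reverseOn_out_in he hy).1 h2
        obtain ⟨⟨h4, h5⟩, h6, h7⟩ := hU.crossing_swap hQ h1 h2
        rw [reverseOn_in_in hx hy]
        exact hQ.adj_right (hU.arrow_of_fullBefore hQ hy hfe c5 h4 h7)
          ((hU.swap hQ).arrow_of_fullBefore hQ.swap hd hfe c1 h6 h5) h0 hn
      · rw [reverseOn_out_out he hy] at h2
        rw [reverseOn_in_out hx hy]
        rcases h1 with h1 | h1
        · have h4 := hU.allBefore_of_allBefore hQ h1 h2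
          exact ⟨h4.2, c3, Or.inl h4.1⟩
        · have hfy := hU.isFree_of_not_adj hy hx c3 hn
          exact ⟨hfy, c3, Or.inl (hU.allBefore_of_fullBefore hQ h1.1 h2 hfy)⟩
  · have hfd := isFull_of_adj hd hx h0.symm
    by_cases he : e ∈ U
    · exact absurd hfd ((reverseOn_out_in hd he).1 h1).1.not_isFull
    · rw [reverseOn_out_out hd he] at h1
      have hK := FullBefore.of_arrow hfd h1
      by_cases hy : y ∈ U
      · obtain ⟨hfe, c5, h2⟩ := (reverseOn_out_in he hy).1 h2
        rw [reverseOn_in_in hx hy]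
        rcases h2 with h2 | ⟨h2, h3⟩
        · exact absurd hK (hU.not_fullBefore hQ h2)
        · have h4 := hU.arrow_of_fullBefore hQ hy hfe c5 hK h3
          obtain ⟨g, hg, h5⟩ := h2
          have c6 := h5.color hQ.swap
          have hgx := hU.adj_of_isFull hg hx (by grind only [color_cases])
          rcases h5 with h5 | ⟨e', b', h5, h6, h7⟩
          · exact hQ.adj_right h4 h5 hgx hn
          · exact hQ.adj_right (hQ.adj_trans h4 h7.symm h6) h5 hgx hn
      · rw [reverseOn_out_out he hy] at h2
        rw [reverseOn_in_out hx hy]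
        have hfy := hU.isFree_of_not_adj hy hx c3 hn
        exact ⟨hfy, c3, Or.inl (hU.allBefore_of_fullBefore hQ hK h2 hfy)⟩

theorem reverseOn_adj_left_of_notMem {x d e y : V} (hx : x ∉ U) (h0 : H.Adj d x)
    (h1 : reverseOn c U Q d e) (h2 : reverseOn c U Q e y) (hn : ¬ H.Adj x y) :
    reverseOn c U Q x y := by
  have c0 := c.valid h0
  have c1 := reverseOn_color hQ h1
  have c2 := reverseOn_color hQ h2
  have c3 : c x ≠ c y := by grind only [color_cases]
  by_cases hd : d ∈ U
  · have hfx := isFull_of_adj hx hd h0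
    by_cases hy : y ∈ U
    · exact absurd (hU.adj_of_isFull hfx hy c3) hn
    rw [reverseOn_out_out hx hy]
    by_cases he : e ∈ U
    · rw [reverseOn_in_in hd he] at h1
      obtain ⟨hfy, -, h2⟩ := (reverseOn_in_out he hy).1 h2
      rcases h2 with h2 | ⟨h2, t, ht, h3⟩
      · obtain ⟨s, hs, t, ht, h3, h4⟩ := hU.exists_arrow_ne x
        have c4 := hQ.color h4
        exact hQ.adj_left (hU.adj_of_isFull hfx hs h3.symm).symm h4
          (h2 t ht (by grind only [color_cases])) hn
      · have h4 := hU.arrow_of_fullBefore hQ he hfy c2 h2 ⟨d, hd, Or.inl h1⟩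
        have c4 : c t ≠ c e := endLT.color (H := H) hQ (h3.imp_right fun ⟨e, _, h⟩ => ⟨e, h⟩)
        have h5 := (hU.adj_of_isFull hfx ht (by grind only [color_cases])).symm
        rcases h3 with h3 | ⟨g, hg, b, h6, h7, h8⟩
        · exact hQ.adj_left h5 h3 h4 hn
        · exact hQ.adj_left h5 h6 (hQ.adj_trans h7 h8 h4) hn
    · obtain ⟨hfe, -, h1⟩ := (reverseOn_in_out hd he).1 h1
      rw [reverseOn_out_out he hy] at h2
      rcases h1 with h1 | h1
      · exact hQ.adj_left h0 (h1 d hd c1) h2 hn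
      · obtain ⟨s, hs, t, ht, h3, h4⟩ := hU.exists_arrow_ne x
        exact hQ.adj_left (hU.adj_of_isFull hfx hs h3.symm).symm
          (hU.arrow_of_fullBefore hQ hs hfe (by grind only [color_cases]) h1.1 ⟨t, ht, Or.inl h4⟩)
          h2 hn
  · by_cases he : e ∈ U
    · obtain ⟨hfd, -, h1⟩ := (reverseOn_out_in hd he).1 h1
      by_cases hy : y ∈ U
      · have hfx := hU.isFree_of_not_adj hx hy c3.symm fun h => hn h.symm
        rw [reverseOn_out_in hx hy]
        exact ⟨hfx, c3.symm,
          Or.inl ((hU.swap hQ).allBefore_of_adj hQ.swap hfd hfx h0 h1.weaken).2⟩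
      · obtain ⟨hfy, -, h2⟩ := (reverseOn_in_out he hy).1 h2
        rw [reverseOn_out_out hx hy]
        rcases isFull_or_isFree hx with hfx | hfx
        · rcases h1 with h1 | ⟨h1, h1'⟩
          · obtain ⟨s, hs, t, ht, h3, h4⟩ := hU.exists_arrow_ne y
            have h5 : Q s y := h2.elim (fun h => h s hs h3)
              fun h => hU.arrow_of_fullBefore hQ hs hfy h3 h.1 ⟨t, ht, Or.inl h4⟩
            exact hQ.adj_left h0 (h1 s hs (by grind only [color_cases])) h5 hn
          · rcases h2 with h2 | ⟨h2, h2'⟩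
            · obtain ⟨t, ht, s, hs, h3, h4⟩ := hU.exists_arrow_to hQ (c e)
              exact hQ.adj_left h0 ((hU.swap hQ).arrow_of_fullBefore hQ.swap ht hfd
                (by grind only [color_cases]) h1 ⟨s, hs, Or.inl h4⟩)
                (h2 t ht (by grind only [color_cases])) hn
            · exact hQ.adj_left h0
                ((hU.swap hQ).arrow_of_fullBefore hQ.swap he hfd c1.symm h1 h2')
                (hU.arrow_of_fullBefore hQ he hfy c2 h2 h1') hn
        · exact hU.arrow_of_free hQ hfx hfy c3
            (Or.inl ((hU.swap hQ).allBefore_of_adj hQ.swap hfd hfx h0 h1.weaken).2) h2.weaken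
    · rw [reverseOn_out_out hd he] at h1
      by_cases hy : y ∈ U
      · obtain ⟨hfe, -, h2⟩ := (reverseOn_out_in he hy).1 h2
        have hfx := hU.isFree_of_not_adj hx hy c3.symm fun h => hn h.symm
        rw [reverseOn_out_in hx hy]
        refine ⟨hfx, c3.symm, ?_⟩
        rcases isFull_or_isFree hd with hfd | hfd
        · rcases h2 with h2 | h2
          · exact absurd (.of_arrow hfd h1) (hU.not_fullBefore hQ h2)
          · exact Or.inr ⟨fullBefore_adj hQ.swap h2.1 h1 h0, h2.2⟩
        · have h3 : AllBefore c U (Function.swap Q) d := by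
            rcases h2 with h2 | h2
            · exact ((hU.swap hQ).allBefore_of_allBefore hQ.swap h2 h1).1
            · exact (hU.swap hQ).allBefore_of_fullBefore hQ.swap h2.1 h1 hfd
          exact Or.inl ((hU.swap hQ).allBefore_of_adj hQ.swap hfd hfx h0 (Or.inl h3)).2
      · rw [reverseOn_out_out he hy] at h2
        rw [reverseOn_out_out hx hy]
        exact hQ.adj_left h0 h1 h2 hn

theorem reverseOn_adj_left {x d e y : V} (h0 : H.Adj d x)
    (h1 : reverseOn c U Q d e) (h2 : reverseOn c U Q e y) (hn : ¬ H.Adj x y) :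
    reverseOn c U Q x y := by
  by_cases hx : x ∈ U
  · exact hU.reverseOn_adj_left_of_mem hQ hx h0 h1 h2 hn
  · exact hU.reverseOn_adj_left_of_notMem hQ hx h0 h1 h2 hn

theorem reverseOn_exchange_of_mem {u b v u' : V} (hu' : u' ∈ U) (h1 : reverseOn c U Q u b)
    (h2 : H.Adj b v) (h3 : H.Adj u u') (hn : ¬ H.Adj u' v) : reverseOn c U Q u' v := by
  have c1 := reverseOn_color hQ h1
  have c2 := c.valid h2
  have c3 := c.valid h3
  have c4 : c u' ≠ c v := by grind only [color_cases]
  by_cases hv : v ∈ U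
  · by_cases hu : u ∈ U <;> by_cases hb : b ∈ U
    · rw [reverseOn_in_in hu hb] at h1
      rw [reverseOn_in_in hu' hv]
      exact hQ.exchange h1 h3 h2 fun h => hn h.symm
    · exact absurd (isFull_of_adj hb hv h2.symm) ((reverseOn_in_out hu hb).1 h1).1.not_isFull
    · exact absurd (isFull_of_adj hu hu' h3.symm) ((reverseOn_out_in hu hb).1 h1).1.not_isFull
    · rw [reverseOn_out_out hu hb] at h1
      exact absurd (isFull_of_adj hb hv h2.symm)
        (hU.isFree_of_arrow hQ (isFull_of_adj hu hu' h3.symm) h1).not_isFull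
  · have hfv := hU.isFree_of_not_adj hv hu' c4 hn
    have hb : b ∉ U := fun hb => hfv.2 b hb h2
    rw [reverseOn_in_out hu' hv]
    refine ⟨hfv, c4, Or.inl ?_⟩
    by_cases hu : u ∈ U
    · obtain ⟨hfb, -, h1⟩ := (reverseOn_in_out hu hb).1 h1
      exact (hU.allBefore_of_adj hQ hfb hfv h2 h1.weaken).2
    · rw [reverseOn_out_out hu hb] at h1
      have hfu := isFull_of_adj hu hu' h3.symm
      exact (hU.allBefore_of_adj hQ (hU.isFree_of_arrow hQ hfu h1) hfv h2
        (Or.inr (.of_arrow hfu h1))).2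

theorem reverseOn_exchange_of_notMem {u b v u' : V} (hu' : u' ∉ U) (hv : v ∉ U) (hu : u ∈ U)
    (h1 : reverseOn c U Q u b)
    (h2 : H.Adj b v) (h3 : H.Adj u u') (hn : ¬ H.Adj u' v) : reverseOn c U Q u' v := by
  have c1 := reverseOn_color hQ h1
  have c2 := c.valid h2
  have c3 := c.valid h3
  have c4 : c u' ≠ c v := by grind only [color_cases]
  have hfu' := isFull_of_adj hu' hu h3
  by_cases hb : b ∈ U
  · exact absurd (hU.full_adj hfu' (isFull_of_adj hv hb h2) c4) hn
  · obtain ⟨hfb, -, h1⟩ := (reverseOn_in_out hu hb).1 h1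
    rw [reverseOn_out_out hu' hv]
    rcases isFull_or_isFree hv with hfv | hfv
    · exact absurd (hU.full_adj hfu' hfv c4) hn
    · have h4 := hU.allBefore_of_adj hQ hfb hfv h2 h1.weaken
      exact hQ.exchange (h4.1 u hu c1) h2 h3 hn

theorem reverseOn_exchange {u b v u' : V} (h1 : reverseOn c U Q u b)
    (h2 : H.Adj b v) (h3 : H.Adj u u') (hn : ¬ H.Adj u' v) : reverseOn c U Q u' v := by
  by_cases hu' : u' ∈ U
  · exact hU.reverseOn_exchange_of_mem hQ hu' h1 h2 h3 hn
  by_cases hv : v ∈ U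
  · have := (hU.swap hQ).reverseOn_exchange_of_mem hQ.swap (u := b) (b := u) (v := u') (u' := v) hv
    simp only [reverseOn_swap, Function.swap] at this
    exact this h1 h3 h2 fun h => hn h.symm
  by_cases hu : u ∈ U
  · exact hU.reverseOn_exchange_of_notMem hQ hu' hv hu h1 h2 h3 hn
  by_cases hb : b ∈ U
  · have := (hU.swap hQ).reverseOn_exchange_of_notMem hQ.swap (u := b) (b := u) (v := u') (u' := v)
      hv hu' hb
    simp only [reverseOn_swap, Function.swap] at this
    exact this h1 h3 h2 fun h => hn h.symm
  · rw [reverseOn_out_out hu hb] at h1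
    rw [reverseOn_out_out hu' hv]
    exact hQ.exchange h1 h2 h3 hn

/-- Reversing an orientation on a reversible set gives an orientation. -/
theorem isOrientation_reverseOn : IsOrientation H c (reverseOn c U Q) where
  color := reverseOn_color hQ
  not_adj := reverseOn_not_adj hQ
  asymm := hU.reverseOn_asymm hQ
  adj_trans := hU.reverseOn_adj_trans hQ
  trans₃ := hU.reverseOn_trans₃ hQ
  adj_left := hU.reverseOn_adj_left hQ
  adj_right {y f b x} h1 h2 h3 h4 := by
    have := (hU.swap hQ).reverseOn_adj_left hQ.swap (x := x) (d := b) (e := f) (y := y)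
    simp only [reverseOn_swap, Function.swap] at this
    exact this h3 h2 h1 h4
  exchange := hU.reverseOn_exchange hQ
  total := hU.reverseOn_total hQ

end IsReversible

end

/-! ### Strong components of the pair-digraph and independence. -/

/-- The pairs `p` and `q` lie in the same strong component of the pair-digraph. -/
def Linked (c : H.Coloring Bool) (p q : V × V) : Prop :=
  ReflTransGen (Arc H c) p q ∧ ReflTransGen (Arc H c) q p

theorem Linked.refl (p : V × V) : Linked c p p := ⟨.refl, .refl⟩

theorem Linked.symm {p q : V × V} (h : Linked c p q) : Linked c q p := ⟨h.2, h.1⟩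

theorem Linked.trans {p q r : V × V} (h : Linked c p q) (h' : Linked c q r) : Linked c p r :=
  ⟨h.1.trans h'.1, h'.2.trans h.2⟩

theorem Arc.swap {p q : V × V} (h : Arc H c p q) : Arc H c q.swap p.swap := by
  cases h with
  | @sameColor u v u' h1 h2 h3 =>
    have := c.valid h2
    exact Arc.diffColor (by grind only [color_cases]) h2.symm h3
  | @diffColor u v v' h1 h2 h3 =>
    have := c.valid h2
    exact Arc.sameColor (by grind only [color_cases]) h2.symm h3

theorem reflTransGen_swap {p q : V × V} (h : ReflTransGen (Arc H c) p q) :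
    ReflTransGen (Arc H c) q.swap p.swap := by
  induction h with
  | refl => exact .refl
  | tail _ h ih => exact .head h.swap ih

theorem Linked.swap {p q : V × V} (h : Linked c p q) : Linked c p.swap q.swap :=
  ⟨reflTransGen_swap h.2, reflTransGen_swap h.1⟩

theorem Arc.ne {p q : V × V} (h : Arc H c p q) : p ≠ q := by
  cases h with
  | sameColor h1 h2 h3 => simpa using h2.ne
  | diffColor h1 h2 h3 => simpa using h2.ne

theorem Independent.exists_left {x y : V} (h : Independent H x y) :
    ∃ x₁, H.Adj x x₁ ∧ Independent H x₁ y := by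
  obtain ⟨x₁, y₁, h1, h2, h3, h4, h5, h6⟩ := h
  exact ⟨x₁, h1, x, y₁, h1.symm, h2, h4, h3, h6, h5⟩

theorem Independent.exists_right {x y : V} (h : Independent H x y) :
    ∃ y₁, H.Adj y y₁ ∧ Independent H x y₁ := by
  obtain ⟨y₁, h1, h2⟩ := h.symm.exists_left
  exact ⟨y₁, h1, h2.symm⟩

/-- An induced `2K₂` with edges `x x₁` and `y y₁` gives the directed cycle `(x, y)`, `(x₁, y)`,
`(x₁, y₁)`, `(x, y₁)`. -/
theorem linked_of_color_eq {x y x₁ : V} (hc : c x = c y) (h : Independent H x y)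
    (h' : H.Adj x x₁) (hn : ¬ H.Adj x₁ y) : Linked c (x, y) (x₁, y) := by
  obtain ⟨-, y₁, -, h2, -, -, h5, -⟩ := h
  have c1 := c.valid h'
  have c2 := c.valid h2
  refine ⟨.single (.sameColor hc h' fun h => hn h.symm), ?_⟩
  refine .head (Arc.diffColor (by grind only [color_cases]) h2 hn) ?_
  refine .head (Arc.sameColor (by grind only [color_cases]) h'.symm fun h => h5 h.symm) ?_
  exact .single (.diffColor (by grind only [color_cases]) h2.symm h5)

theorem Independent.linked_left {x y x₁ : V} (c : H.Coloring Bool) (h : Independent H x y)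
    (h₁ : Independent H x₁ y) (h' : H.Adj x x₁) : Linked c (x, y) (x₁, y) := by
  have c1 := c.valid h'
  by_cases hc : c x = c y
  · exact linked_of_color_eq hc h h' h₁.not_adj
  · exact (linked_of_color_eq (by grind only [color_cases]) h₁ h'.symm h.not_adj).symm

theorem Independent.linked_right {x y y₁ : V} (c : H.Coloring Bool) (h : Independent H x y)
    (h₁ : Independent H x y₁) (h' : H.Adj y y₁) : Linked c (x, y) (x, y₁) :=
  (h.symm.linked_left c h₁.symm h').swap

/-- The arc itself supplies one edge of the `2K₂`. The other comes from the arc entering `p` when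
the colours agree, and from the arc leaving `q` when they differ. -/
theorem independent_of_cycle {p q : V × V} (h : Arc H c p q) (h' : ReflTransGen (Arc H c) q p) :
    Independent H p.1 p.2 := by
  cases h with
  | @sameColor u v u' h1 h2 h3 =>
    rcases ReflTransGen.cases_tail h' with h4 | ⟨r, -, h4⟩
    · simp only [Prod.mk.injEq, and_true] at h4
      exact absurd h4 h2.ne
    · cases h4 with
      | sameColor h5 h6 h7 => exact absurd (h5.trans h1.symm) (c.valid h6)
      | diffColor h5 h6 h7 =>
        exact .of_color_eq c h1 h2 h6.symm (fun h => h3 h.symm) h7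
  | @diffColor u v v' h1 h2 h3 =>
    rcases ReflTransGen.cases_head h' with h4 | ⟨r, h4, -⟩
    · simp only [Prod.mk.injEq, true_and] at h4
      exact absurd h4 h2.symm.ne
    · have := c.valid h2
      cases h4 with
      | sameColor h5 h6 h7 => exact .of_color_ne c h1 h6 h2 h3 fun h => h7 h.symm
      | diffColor h5 h6 h7 => exact absurd (show c u = c v' by grind only [color_cases]) h5

theorem independent_of_linked_of_ne {p q : V × V} (h : Linked c p q) (hne : p ≠ q) :
    Independent H p.1 p.2 := by
  rcases ReflTransGen.cases_head h.1 with h1 | ⟨r, h1, h2⟩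
  · exact absurd h1 hne
  · exact independent_of_cycle h1 (h2.trans h.2)

theorem Independent.of_linked {p q : V × V} (hp : Independent H p.1 p.2) (h : Linked c p q) :
    Independent H q.1 q.2 := by
  by_cases hpq : p = q
  · exact hpq ▸ hp
  · exact independent_of_linked_of_ne h.symm (Ne.symm hpq)

/-- Inside a component each arc moves one coordinate along an edge and keeps the pair independent,
so inductions over it can ignore colours. -/
theorem linked_induction {p q : V × V} (hp : Independent H p.1 p.2) {P : V → V → Prop}
    (h0 : P p.1 p.2)
    (left : ∀ a a₁ b, Linked c p (a, b) → Independent H a b → Independent H a₁ b → H.Adj a a₁ →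
      P a b → P a₁ b)
    (right : ∀ a b b₁, Linked c p (a, b) → Independent H a b → Independent H a b₁ → H.Adj b b₁ →
      P a b → P a b₁)
    (h : Linked c p q) : P q.1 q.2 := by
  obtain ⟨h1, h2⟩ := h
  induction h1 with
  | refl => exact h0
  | @tail r s h1 h3 ih =>
    have hr : Linked c p r := ⟨h1, .head h3 h2⟩
    have hs : Linked c p s := ⟨.tail h1 h3, h2⟩
    have ir := hp.of_linked hr
    have is := hp.of_linked hs
    have ih := ih (.head h3 h2)
    cases h3 with
    | sameColor h4 h5 h6 => exact left _ _ _ hr ir is h5 ih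
    | diffColor h4 h5 h6 => exact right _ _ _ hr ir is h5 ih

theorem IsOrientation.endOrder_of_linked {Q : V → V → Prop} (hQ : IsOrientation H c Q)
    {p q : V × V} (h : Linked c p q) (hp : endOrder H Q p.1 p.2) : endOrder H Q q.1 q.2 := by
  obtain ⟨h1, -⟩ := h
  induction h1 with
  | refl => exact hp
  | tail _ h ih => exact hQ.endOrder_arc ih h

/-! ### The span of a component behaves like a module. -/

/-- The vertices occurring in the strong component of a pair. -/
def span (c : H.Coloring Bool) (p : V × V) : Set V :=
  {v | ∃ q, Linked c p q ∧ (v = q.1 ∨ v = q.2)}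

theorem fst_mem_span {p q : V × V} (h : Linked c p q) : q.1 ∈ span c p := ⟨q, h, Or.inl rfl⟩

theorem snd_mem_span {p q : V × V} (h : Linked c p q) : q.2 ∈ span c p := ⟨q, h, Or.inr rfl⟩

theorem span_subset_of_linked {p q : V × V} (h : Linked c p q) : span c q ⊆ span c p := by
  rintro v ⟨r, h1, h2⟩
  exact ⟨r, h.trans h1, h2⟩

theorem span_eq_of_linked {p q : V × V} (h : Linked c p q) : span c p = span c q :=
  (span_subset_of_linked h.symm).antisymm (span_subset_of_linked h)

theorem span_swap_subset (p : V × V) : span c p.swap ⊆ span c p := by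
  rintro v ⟨r, h1, h2⟩
  exact ⟨r.swap, h1.swap, h2.symm⟩

theorem span_swap (p : V × V) : span c p.swap = span c p :=
  (span_swap_subset p).antisymm (span_swap_subset p.swap)

/-- `z` sees everything that `x` sees, or `x` itself if the colours differ. -/
def Absorbs (c : H.Coloring Bool) (z x : V) : Prop :=
  (c z ≠ c x → H.Adj z x) ∧ (c z = c x → ∀ w, H.Adj x w → H.Adj z w)

/-- A failure to absorb `y` would complete a `2K₂` making `z` and `y` independent, with `z` adjacent
to `x` or `x₁`; then `(z, y)` would belong to the component and `z` to its span. -/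
theorem Absorbs.of_linked {p : V × V} {x y z : V} (hz : z ∉ span c p) (hp : Linked c p (x, y))
    (h : Independent H x y) (hx : Absorbs c z x) : Absorbs c z y := by
  have key : ∀ a, Linked c p (a, y) → Independent H a y → H.Adj a z → ¬ Independent H z y :=
    fun a h1 h2 h3 h4 => hz (fst_mem_span (h1.trans (h2.linked_left c h4 h3)))
  obtain ⟨x₁, y₁, h1, h2, h3, h4, h5, h6⟩ := h
  have i0 : Independent H x y := ⟨x₁, y₁, h1, h2, h3, h4, h5, h6⟩
  have i1 : Independent H x₁ y := ⟨x, y₁, h1.symm, h2, h4, h3, h6, h5⟩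
  have l1 := hp.trans (i0.linked_left c i1 h1)
  by_cases hzx : c z = c x
  · have hzx₁ := hx.2 hzx x₁ h1
    refine ⟨fun hc => ?_, fun hc w hw => ?_⟩
    · by_contra hn
      exact key x₁ l1 i1 hzx₁.symm (.of_color_ne c hc hzx₁ h2 hn h6)
    · by_contra hn
      exact key x₁ l1 i1 hzx₁.symm (.of_color_eq c hc hzx₁ hw h4 hn)
  · have hzx' := hx.1 hzx
    refine ⟨fun hc => ?_, fun hc w hw => ?_⟩
    · by_contra hn
      exact key x hp i0 hzx'.symm (.of_color_ne c hc hzx' h2 hn h5)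
    · by_contra hn
      exact key x hp i0 hzx'.symm (.of_color_eq c hc hzx' hw h3 hn)

theorem absorbs_of_mem_span {p : V × V} (hp : Independent H p.1 p.2) {z u v : V}
    (hz : z ∉ span c p) (hu : u ∈ span c p) (hv : v ∈ span c p) (h : Absorbs c z u) :
    Absorbs c z v := by
  have hz' : z ∉ span c p.swap := by rwa [span_swap]
  have step : ∀ {a b}, Linked c p (a, b) → (Absorbs c z a ↔ Absorbs c z b) := fun {a b} hab =>
    ⟨fun h => h.of_linked hz hab (hp.of_linked hab),
      fun h => h.of_linked hz' hab.swap (hp.of_linked hab).symm⟩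
  obtain ⟨q, hq, huq⟩ := hu
  obtain ⟨r, hr, hvr⟩ := hv
  have h1 : Absorbs c z q.1 := by
    rcases huq with rfl | rfl
    · exact h
    · exact (step hq).2 h
  have h2 : Absorbs c z r.1 ∧ Absorbs c z r.2 := by
    refine linked_induction (hp.of_linked hq) (P := fun a b => Absorbs c z a ∧ Absorbs c z b)
      ⟨h1, (step hq).1 h1⟩ ?_ ?_ (hq.symm.trans hr)
    · intro a a₁ b h3 h4 h5 h6 h7
      exact ⟨(step (hq.trans (h3.trans (h4.linked_left c h5 h6)))).2 h7.2, h7.2⟩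
    · intro a b b₁ h3 h4 h5 h6 h7
      exact ⟨h7.1, (step (hq.trans (h3.trans (h4.linked_right c h5 h6)))).1 h7.1⟩
  rcases hvr with rfl | rfl
  · exact h2.1
  · exact h2.2

theorem span_uniform {p : V × V} (hp : Independent H p.1 p.2) {z u v : V}
    (hz : z ∉ span c p) (hu : u ∈ span c p) (hv : v ∈ span c p) (h : H.Adj z u)
    (hc : c z ≠ c v) : H.Adj z v :=
  (absorbs_of_mem_span hp hz hu hv ⟨fun _ => h, fun h' => absurd h' (c.valid h)⟩).1 hc

theorem exists_linked_color_ne {p : V × V} (hp : Independent H p.1 p.2) :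
    ∃ y, Linked c p (p.1, y) ∧ c p.1 ≠ c y := by
  by_cases hc : c p.1 = c p.2
  · obtain ⟨y, h1, h2⟩ := hp.exists_right
    have := c.valid h1
    exact ⟨y, hp.linked_right c h2 h1, by grind only [color_cases]⟩
  · exact ⟨p.2, .refl p, hc⟩

/-- If `z` and `w` were nonadjacent, the edges `p.1 z` and `b w` would form a `2K₂`, bringing `(p.1,
w)` into the component. -/
theorem span_full_adj {p : V × V} (hp : Independent H p.1 p.2) {z w : V}
    (hz : IsFull H (span c p) z) (hw : IsFull H (span c p) w) (hc : c z ≠ c w) : H.Adj z w := by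
  obtain ⟨b, hb, hcb⟩ := exists_linked_color_ne (c := c) hp
  have ib : Independent H p.1 b := hp.of_linked hb
  have key : ∀ {z w : V}, IsFull H (span c p) z → IsFull H (span c p) w → c z ≠ c w →
      c p.1 ≠ c z → H.Adj z w := by
    rintro z w ⟨hz, u, hu, hzu⟩ ⟨hw, v, hv, hwv⟩ hc hcz
    by_contra hn
    have h1 := span_uniform hp hz hu (fst_mem_span hb) hzu hcz.symm
    have h2 := span_uniform hp hw hv (snd_mem_span hb) hwv (by grind only [color_cases])
    have h3 : Independent H p.1 w :=
      .of_color_eq c (by grind only [color_cases]) h1.symm h2 hn ib.not_adj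
    exact hw (snd_mem_span (hb.trans (ib.linked_right c h3 h2.symm)))
  by_cases h : c p.1 = c z
  · exact (key hw hz hc.symm (by grind only [color_cases])).symm
  · exact key hz hw hc h

theorem span_exists_adj {p : V × V} (hp : Independent H p.1 p.2) {u : V} (hu : u ∈ span c p) :
    ∃ v ∈ span c p, H.Adj u v := by
  obtain ⟨q, hq, rfl | rfl⟩ := hu
  · obtain ⟨v, h1, h2⟩ := (hp.of_linked hq).exists_left
    exact ⟨v, fst_mem_span (hq.trans ((hp.of_linked hq).linked_left c h2 h1)), h1⟩
  · obtain ⟨v, h1, h2⟩ := (hp.of_linked hq).exists_right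
    exact ⟨v, snd_mem_span (hq.trans ((hp.of_linked hq).linked_right c h2 h1)), h1⟩

theorem isReversible_span {Q : V → V → Prop} (hQ : IsOrientation H c Q) {x y : V}
    (h : Independent H x y) (hxy : Q x y)
    (ha : ∀ {z w}, IsFree H (span c (x, y)) z → IsFree H (span c (x, y)) w → H.Adj z w →
      AllBefore c (span c (x, y)) Q z ∨ AllBefore c (span c (x, y)) (Function.swap Q) z) :
    IsReversible c (span c (x, y)) Q where
  uniform h1 h2 h3 h4 h5 := span_uniform (p := (x, y)) h h1 h2 h3 h4 h5
  full_adj h1 h2 h3 := span_full_adj (p := (x, y)) h h1 h2 h3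
  exists_adj h1 := span_exists_adj (p := (x, y)) h h1
  aligned := ha
  exists_arrow k := by
    have l0 : Linked c (x, y) (x, y) := .refl _
    obtain ⟨x₁, y₁, h1, h2, h3, h4, h5, h6⟩ := h
    have i0 : Independent H x y := ⟨x₁, y₁, h1, h2, h3, h4, h5, h6⟩
    have i1 : Independent H x₁ y := ⟨x, y₁, h1.symm, h2, h4, h3, h6, h5⟩
    have i2 : Independent H x₁ y₁ := ⟨x, y, h1.symm, h2.symm, h6, h5, h4, h3⟩
    have l1 : Linked c (x, y) (x₁, y₁) := (i0.linked_left c i1 h1).trans (i1.linked_right c i2 h2)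
    have c1 := c.valid h1
    by_cases hk : c x = k
    · exact ⟨x, fst_mem_span l0, y, snd_mem_span l0, hk, hxy⟩
    · refine ⟨x₁, fst_mem_span l1, y₁, snd_mem_span l1, ?_, hQ.exchange hxy h2 h1 h6⟩
      revert c1 hk
      cases c x <;> cases c x₁ <;> cases k <;> simp

/-- An edge leaving the larger span ends in a full vertex, which has too many neighbours to be
independent of a vertex of that span. -/
theorem span_subset_span {p q : V × V} (hp : Independent H p.1 p.2) (hq : Independent H q.1 q.2)
    (h1 : q.1 ∈ span c p) (h2 : q.2 ∈ span c p) : span c q ⊆ span c p := by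
  have key : ∀ {a a₁ b : V}, Independent H a₁ b → H.Adj a a₁ → a ∈ span c p → b ∈ span c p →
      a₁ ∈ span c p := by
    intro a a₁ b h3 h4 h5 h6
    by_contra hn
    have hf : IsFull H (span c p) a₁ := ⟨hn, a, h5, h4.symm⟩
    by_cases hc : c a₁ = c b
    · obtain ⟨-, b₁, -, h7, -, -, h8, -⟩ := h3
      have c1 := c.valid h7
      by_cases hb : b₁ ∈ span c p
      · exact h8 (span_uniform hp hn h5 hb h4.symm (by grind only))
      · exact h8 (span_full_adj hp hf ⟨hb, b, h6, h7.symm⟩ (by grind only))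
    · exact h3.not_adj (span_uniform hp hn h5 h6 h4.symm hc)
  have : ∀ r, Linked c q r → r.1 ∈ span c p ∧ r.2 ∈ span c p := by
    intro r hr
    refine linked_induction hq (P := fun a b => a ∈ span c p ∧ b ∈ span c p) ⟨h1, h2⟩ ?_ ?_ hr
    · intro a a₁ b _ _ h3 h4 h5
      exact ⟨key h3 h4 h5.1 h5.2, h5.2⟩
    · intro a b b₁ _ _ h3 h4 h5
      exact ⟨h5.1, key h3.symm h4 h5.2 h5.1⟩
  rintro v ⟨r, hr, rfl | rfl⟩
  · exact (this r hr).1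
  · exact (this r hr).2

/-! ### The span determines a component up to coupling. -/

/-- If `a` lost its independence when `b` moves to `b₁`, the resulting adjacency would let `(a, d)`
slide to `(b, d)` within one component. -/
theorem independent_of_not_linked {a b d b₁ : V} (hab : Independent H a b)
    (had : Independent H a d) (hbd : Independent H b d) (h : H.Adj b b₁)
    (hb₁ : Independent H b₁ d) (hl : ¬ Linked c (a, d) (b, d)) : Independent H a b₁ := by
  by_contra hn
  have c1 := c.valid h
  have lb := hbd.linked_left c hb₁ h
  by_cases hc : c a = c b
  · obtain ⟨a₁, -, h1, -, -, h2, -, -⟩ := hab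
    by_cases h3 : H.Adj a b₁
    · exact hl ((had.linked_left c hb₁ h3).trans lb.symm)
    · exact hn (.of_color_ne c (by grind only) h1 h.symm h3 h2)
  · obtain ⟨a₁, h1, h2⟩ := had.exists_left
    have h3 : H.Adj a₁ b₁ := by
      by_contra h3
      exact hn (.of_color_eq c (by grind only [color_cases]) h1 h.symm h3 hab.not_adj)
    exact hl ((had.linked_left c h2 h1).trans ((h2.linked_left c hb₁ h3).trans lb.symm))

/-- An analogue of Gallai's triangle lemma: along the whole component of `(b, d)` the vertex `a`
stays independent of both coordinates, so it never equals one of them. -/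
theorem notMem_span_of_not_linked {a b d : V} (hab : Independent H a b)
    (had : Independent H a d) (hbd : Independent H b d)
    (h1 : ¬ Linked c (a, d) (b, d)) (h2 : ¬ Linked c (a, b) (d, b)) : a ∉ span c (b, d) := by
  have key : ∀ r, Linked c (b, d) r → Independent H a r.1 ∧ Independent H a r.2 ∧
      Linked c (a, b) (a, r.1) ∧ Linked c (a, d) (a, r.2) := by
    intro r hr
    refine linked_induction (p := (b, d)) hbd (P := fun x y => Independent H a x ∧
      Independent H a y ∧ Linked c (a, b) (a, x) ∧ Linked c (a, d) (a, y))
      ⟨hab, had, .refl _, .refl _⟩ ?_ ?_ hr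
    · rintro x x₁ y l0 i0 i1 h3 ⟨i2, i3, l2, l3⟩
      have i4 := independent_of_not_linked (c := c) i2 i3 i0 h3 i1
        fun h => h1 (l3.trans (h.trans l0.symm))
      exact ⟨i4, i3, l2.trans (i2.linked_right c i4 h3), l3⟩
    · rintro x y y₁ l0 i0 i1 h3 ⟨i2, i3, l2, l3⟩
      have i4 := independent_of_not_linked (c := c) i3 i2 i0.symm h3 i1.symm
        fun h => h2 (l2.trans (h.trans l0.swap.symm))
      exact ⟨i2, i4, l2, l3.trans (i3.linked_right c i4 h3)⟩
  rintro ⟨r, hr, rfl | rfl⟩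
  · exact (key r hr).1.ne rfl
  · exact (key r hr).2.1.ne rfl

/-- Otherwise the `2K₂` of `v` and `s` carries `(v, s)` through `(v₁, s₁)` to `(v, t)`. -/
theorem exists_adj_not_adj {v s t : V} (hs : Independent H v s) (ht : Independent H v t)
    (hct : c v ≠ c t) (h : ¬ Linked c (v, s) (v, t)) :
    ∃ w, H.Adj s w ∧ ¬ H.Adj w t := by
  by_contra! hn
  obtain ⟨v₁, s₁, h1, h2, h3, h4, h5, h6⟩ := hs
  have i0 : Independent H v s := ⟨v₁, s₁, h1, h2, h3, h4, h5, h6⟩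
  have i1 : Independent H v₁ s := ⟨v, s₁, h1.symm, h2, h4, h3, h6, h5⟩
  have i2 : Independent H v₁ s₁ := ⟨v, s, h1.symm, h2.symm, h6, h5, h4, h3⟩
  have c1 := c.valid h1
  have i3 : Independent H v₁ t := .of_color_eq c (by grind only [color_cases]) h1.symm
    (hn s₁ h2).symm ht.not_adj h6
  exact h ((i0.linked_left c i1 h1).trans ((i1.linked_right c i2 h2).trans
    ((i2.linked_right c i3 (hn s₁ h2)).trans (i3.linked_left c ht h1.symm))))

theorem span_ne_of_not_linked {v s t : V} (hs : Independent H v s) (ht : Independent H v t)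
    (hcs : c v ≠ c s) (hct : c v ≠ c t) (h : ¬ Linked c (v, s) (v, t))
    (h' : ¬ Linked c (v, s) (t, v)) : span c (v, s) ≠ span c (v, t) := by
  obtain ⟨s₁, h1, h2⟩ := exists_adj_not_adj hs ht hct h
  obtain ⟨t₁, h3, h4⟩ := exists_adj_not_adj ht hs hcs fun h' => h h'.symm
  have hst : Independent H s t :=
    .of_color_eq c (by grind only [color_cases]) h1 h3 h2 fun h => h4 h.symm
  intro heq
  -- The vertices `v`, `s`, `t` are pairwise independent. If `(t, s)` is linked to `(v, s)`, it is
  -- not linked to `(t, v)`, so `s` misses the span of `(v, t)`; otherwise `t` misses that of `(v,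
  -- s)`.
  by_cases hl : Linked c (t, s) (v, s)
  · refine notMem_span_of_not_linked (c := c) hs.symm hst ht (fun h1 => ?_)
      (fun h1 => h h1.swap) (heq ▸ snd_mem_span (.refl (v, s)))
    exact h' (hl.symm.trans h1.swap)
  · exact notMem_span_of_not_linked (c := c) ht.symm hst.symm hs hl
      (fun h1 => h h1.swap.symm) (heq ▸ snd_mem_span (.refl (v, t)))

/-- Up to coupling, both components contain pairs `(p.1, s)` and `(p.1, t)` with a common first
vertex and `s`, `t` of the other colour, which reduces to `span_ne_of_not_linked`. -/
theorem linked_of_span_eq {p q : V × V} (hp : Independent H p.1 p.2) (hq : Independent H q.1 q.2)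
    (h : span c p = span c q) : Linked c p q ∨ Linked c p q.swap := by
  obtain ⟨s, hs, hcs⟩ := exists_linked_color_ne (c := c) hp
  have is : Independent H p.1 s := hp.of_linked hs
  have hv : p.1 ∈ span c q := h ▸ fst_mem_span (.refl p)
  by_contra! hn
  obtain ⟨r, hr, hpr⟩ : ∃ r, (Linked c q r ∨ Linked c q.swap r) ∧ p.1 = r.1 := by
    obtain ⟨r, hr, h1 | h1⟩ := hv
    · exact ⟨r, Or.inl hr, h1⟩
    · exact ⟨r.swap, Or.inr hr.swap, h1⟩
  have ir : Independent H r.1 r.2 := hr.elim hq.of_linked (Independent.of_linked (p := q.swap) hq.symm)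
  obtain ⟨t, ht, hct⟩ := exists_linked_color_ne (c := c) ir
  have it : Independent H r.1 t := ir.of_linked ht
  rw [← hpr] at ht hct it
  have hr' : Linked c q (p.1, t) ∨ Linked c q.swap (p.1, t) :=
    hr.imp (fun h => h.trans ht) fun h => h.trans ht
  have hsp : span c (p.1, s) = span c (p.1, t) := by
    rw [← span_eq_of_linked hs, h]
    rcases hr' with h1 | h1
    · exact span_eq_of_linked h1
    · rw [← span_eq_of_linked h1, span_swap]
  refine span_ne_of_not_linked is it hcs hct (fun h1 => ?_) (fun h1 => ?_) hsp
  · rcases hr' with h2 | h2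
    · exact hn.1 (hs.trans (h1.trans h2.symm))
    · exact hn.2 (hs.trans (h1.trans h2.symm))
  · rcases hr' with h2 | h2
    · exact hn.2 (hs.trans (h1.trans h2.swap.symm))
    · exact hn.1 (hs.trans (h1.trans h2.swap.symm))

/-! ### Disagreements between a selection and an orientation. -/

/-- `F` chooses one of any two coupled components, without circuits of length two or three. -/
structure IsSelection (c : H.Coloring Bool) (F : V → V → Prop) : Prop where
  linked : ∀ {p q : V × V}, F p.1 p.2 → Linked c p q → F q.1 q.2
  total : ∀ {x y}, Independent H x y → F x y ∨ F y x
  asymm : ∀ {x y}, F x y → ¬ F y x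
  acyclic : ∀ {x y z}, F x y → F y z → ¬ F z x

theorem IsSelection.swap {F : V → V → Prop} (hF : IsSelection c F) :
    IsSelection c (Function.swap F) where
  linked h1 h2 := hF.linked (p := Prod.swap _) (q := Prod.swap _) h1 h2.swap
  total h := (hF.total h).symm
  asymm h h' := hF.asymm h h'
  acyclic h1 h2 h3 := hF.acyclic h2 h1 h3

/-- The arrow `p` of the orientation `Q` is opposite to the selection `F`. -/
def Disagrees (H : SimpleGraph V) (F Q : V → V → Prop) (p : V × V) : Prop :=
  Independent H p.1 p.2 ∧ Q p.1 p.2 ∧ F p.2 p.1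

theorem Disagrees.swap {F Q : V → V → Prop} {p : V × V} (h : Disagrees H F Q p) :
    Disagrees H (Function.swap F) (Function.swap Q) p.swap := ⟨h.1.symm, h.2⟩

/-- The vertices lying between the two sides of the strong component of `p`. -/
def between (c : H.Coloring Bool) (Q : V → V → Prop) (p : V × V) : Set V :=
  {v | ∀ q, Linked c p q → (c q.1 ≠ c v → Q q.1 v) ∧ (c v ≠ c q.2 → Q v q.2)}

theorem between_swap_subset (Q : V → V → Prop) (p : V × V) :
    between c (Function.swap Q) p.swap ⊆ between c Q p := by
  intro v hv q hq
  have := hv q.swap hq.swap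
  exact ⟨fun h => this.2 h.symm, fun h => this.1 h.symm⟩

theorem between_swap (Q : V → V → Prop) (p : V × V) :
    between c (Function.swap Q) p.swap = between c Q p :=
  (between_swap_subset Q p).antisymm (between_swap_subset (Function.swap Q) p.swap)

theorem endOrder_or_of_independent {Q : V → V → Prop} (hQ : IsOrientation H c Q) {x y : V}
    (h : Independent H x y) : endOrder H Q x y ∨ endOrder H Q y x := by
  obtain ⟨b, hb, hc⟩ := exists_linked_color_ne (c := c) (p := (x, y)) h
  have ib : Independent H x b := h.of_linked (p := (x, y)) hb
  rcases hQ.total ib hc with h1 | h1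
  · exact Or.inl (hQ.endOrder_of_linked hb.symm ((hQ.endOrder_iff hc ib.not_adj).2 h1))
  · exact Or.inr (hQ.endOrder_of_linked hb.symm.swap
      ((hQ.endOrder_iff hc.symm ib.symm.not_adj).2 h1))

theorem endOrder_swap {Q : V → V → Prop} (hQ : IsOrientation H c Q) {x y : V}
    (h : Independent H x y) (h' : endOrder H Q x y) : endOrder H (Function.swap Q) y x := by
  obtain ⟨b, hb, hc⟩ := exists_linked_color_ne (c := c) (p := (x, y)) h
  have ib : Independent H x b := h.of_linked (p := (x, y)) hb
  have h1 : Q x b := (hQ.endOrder_iff hc ib.not_adj).1 (hQ.endOrder_of_linked hb h')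
  exact hQ.swap.endOrder_of_linked hb.swap.symm
    ((hQ.swap.endOrder_iff hc.symm ib.symm.not_adj).2 h1)

theorem independent_of_isFree {p : V × V} (hp : Independent H p.1 p.2) {u z w : V}
    (hu : u ∈ span c p) (hz : IsFree H (span c p) z) (hw : IsFree H (span c p) w)
    (h : H.Adj z w) : Independent H u z := by
  obtain ⟨v, hv, huv⟩ := span_exists_adj hp hu
  exact ⟨v, w, huv, h, hz.2 u hu, hz.2 v hv, hw.2 u hu, hw.2 v hv⟩

theorem linked_of_isFree {p q : V × V} (hp : Independent H p.1 p.2) {z w : V}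
    (hz : IsFree H (span c p) z) (hw : IsFree H (span c p) w) (h : H.Adj z w)
    (hq : Linked c p q) : Linked c (p.1, z) (q.1, z) ∧ Linked c (z, p.2) (z, q.2) := by
  refine linked_induction hp (P := fun a b => Linked c (p.1, z) (a, z) ∧ Linked c (z, p.2) (z, b))
    ⟨.refl _, .refl _⟩ ?_ ?_ hq
  · intro a a₁ b l0 i0 i1 h1 h2
    have l1 := l0.trans (i0.linked_left c i1 h1)
    exact ⟨h2.1.trans ((independent_of_isFree hp (fst_mem_span l0) hz hw h).linked_left c
      (independent_of_isFree hp (fst_mem_span l1) hz hw h) h1), h2.2⟩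
  · intro a b b₁ l0 i0 i1 h1 h2
    have l1 := l0.trans (i0.linked_right c i1 h1)
    exact ⟨h2.1, h2.2.trans ((independent_of_isFree hp (snd_mem_span l0) hz hw h).symm.linked_right c
      (independent_of_isFree hp (snd_mem_span l1) hz hw h).symm h1)⟩

section

variable {Q F : V → V → Prop} (hQ : IsOrientation H c Q) (hF : IsSelection c F)
include hQ

/-- The vertex `z` witnesses strictness: its neighbour `w` is a second coordinate in the component
of `(p.1, z)`, so `z` being between there would put an arrow on the edge `z w`. -/
theorem between_ssubset {p r : V × V} (hp : Independent H p.1 p.2) {z w : V}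
    (hz : IsFree H (span c p) z) (hw : IsFree H (span c p) w) (h : H.Adj z w)
    (h1 : endOrder H Q p.1 z) (h2 : endOrder H Q z p.2) (hr : Linked c (p.1, z) r) :
    between c Q r ⊂ between c Q p := by
  have hc := c.valid h
  have iz : ∀ {u}, u ∈ span c p → Independent H u z := fun hu => independent_of_isFree hp hu hz hw h
  have iw : ∀ {u}, u ∈ span c p → Independent H u w :=
    fun hu => independent_of_isFree hp hu hw hz h.symm
  have l1 : ∀ {q}, Linked c p q → Linked c (p.1, z) (q.1, z) ∧ Linked c (p.1, z) (q.1, w) := by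
    intro q hq
    have h3 := (linked_of_isFree hp hz hw h hq).1
    exact ⟨h3, h3.trans ((iz (fst_mem_span hq)).linked_right c (iw (fst_mem_span hq)) h)⟩
  have l2 : ∀ {q}, Linked c p q → Linked c (z, p.2) (z, q.2) ∧ Linked c (z, p.2) (w, q.2) := by
    intro q hq
    have h3 := (linked_of_isFree hp hz hw h hq).2
    exact ⟨h3, h3.trans ((iz (snd_mem_span hq)).symm.linked_left c (iw (snd_mem_span hq)).symm h)⟩
  refine (Set.ssubset_iff_of_subset ?_).2 ⟨z, ?_, ?_⟩
  · intro v hv q hq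
    have h3 := hv _ (hr.symm.trans (l1 hq).1)
    have h4 := hv _ (hr.symm.trans (l1 hq).2)
    refine ⟨h3.1, fun h5 => ?_⟩
    by_cases h6 : c v = c z
    · have h7 : Q z q.2 := (hQ.endOrder_iff (by grind only) (iz (snd_mem_span hq)).symm.not_adj).1
        (hQ.endOrder_of_linked (l2 hq).1 h2)
      exact hQ.adj_trans (h4.2 (by grind only)) h.symm h7
    · have h7 : Q w q.2 := (hQ.endOrder_iff (by grind only [color_cases])
        (iw (snd_mem_span hq)).symm.not_adj).1 (hQ.endOrder_of_linked (l2 hq).2 h2)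
      exact hQ.adj_trans (h3.2 h6) h h7
  · intro q hq
    exact ⟨fun h3 => (hQ.endOrder_iff h3 (iz (fst_mem_span hq)).not_adj).1
        (hQ.endOrder_of_linked (l1 hq).1 h1),
      fun h3 => (hQ.endOrder_iff h3 (iz (snd_mem_span hq)).symm.not_adj).1
        (hQ.endOrder_of_linked (l2 hq).1 h2)⟩
  · intro h3
    exact hQ.not_adj ((h3 _ (hr.symm.trans (l1 (.refl p)).2)).2 hc) h

include hF

theorem exists_disagrees_between {p : V × V} (hp : Independent H p.1 p.2) {z w : V}
    (hz : IsFree H (span c p) z) (hw : IsFree H (span c p) w) (h : H.Adj z w)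
    (h1 : endOrder H Q p.1 z) (h2 : endOrder H Q z p.2) (h3 : F z p.1) :
    ∃ r, Disagrees H F Q r ∧ between c Q r ⊂ between c Q p := by
  have iz : Independent H p.1 z := independent_of_isFree hp (fst_mem_span (.refl p)) hz hw h
  -- An orientation only relates different colours, so `z` is traded for some `b` within the
  -- component.
  obtain ⟨b, hb, hcb⟩ := exists_linked_color_ne (c := c) (p := (p.1, z)) iz
  have ib : Independent H p.1 b := iz.of_linked (p := (p.1, z)) hb
  exact ⟨(p.1, b), ⟨ib, (hQ.endOrder_iff hcb ib.not_adj).1 (hQ.endOrder_of_linked hb h1),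
    hF.linked (p := (z, p.1)) h3 hb.swap⟩, between_ssubset hQ hp hz hw h h1 h2 hb⟩

theorem exists_isReversible [Finite V] {p₀ : V × V} (h₀ : Disagrees H F Q p₀) :
    ∃ p, Disagrees H F Q p ∧ IsReversible c (span c p) Q := by
  obtain ⟨p, hp, hmin⟩ := (measure fun p => (between c Q p).ncard).wf.has_min
    {p | Disagrees H F Q p} ⟨p₀, h₀⟩
  have hmin' : ∀ r, Disagrees H F Q r → ¬ between c Q r ⊂ between c Q p :=
    fun r hr h => hmin r hr (Set.ncard_lt_ncard h (Set.toFinite _))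
  have hp' : Disagrees H F Q p := hp
  obtain ⟨ip, hQp, hFp⟩ := hp
  refine ⟨p, ⟨ip, hQp, hFp⟩, isReversible_span hQ ip hQp fun {z w} hz hw h => ?_⟩
  have hz : IsFree H (span c p) z := hz
  have hw : IsFree H (span c p) w := hw
  have iz : ∀ {u}, u ∈ span c p → Independent H u z := fun hu => independent_of_isFree ip hu hz hw h
  have lz := fun {q} (hq : Linked c p q) => linked_of_isFree ip hz hw h hq
  have h0 : endOrder H Q p.1 p.2 := (hQ.endOrder_iff (hQ.color hQp) ip.not_adj).2 hQp
  have before : endOrder H Q p.1 z → endOrder H Q p.2 z → AllBefore c (span c p) Q z := by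
    rintro h1 h2 u hu hc
    refine (hQ.endOrder_iff hc (iz hu).not_adj).1 ?_
    obtain ⟨q, hq, rfl | rfl⟩ := hu
    · exact hQ.endOrder_of_linked (lz hq).1 h1
    · exact hQ.endOrder_of_linked (lz hq).2.swap h2
  have after : endOrder H Q z p.1 → endOrder H Q z p.2 →
      AllBefore c (span c p) (Function.swap Q) z := by
    rintro h1 h2 u hu hc
    refine (hQ.endOrder_iff hc.symm (iz hu).symm.not_adj).1 ?_
    obtain ⟨q, hq, rfl | rfl⟩ := hu
    · exact hQ.endOrder_of_linked (lz hq).1.swap h1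
    · exact hQ.endOrder_of_linked (lz hq).2 h2
  rcases endOrder_or_of_independent hQ (iz (fst_mem_span (.refl p))) with h1 | h1 <;>
    rcases endOrder_or_of_independent hQ (iz (snd_mem_span (.refl p))) with h2 | h2
  · exact Or.inl (before h1 h2)
  · exfalso
    -- Here `z` lies between `p.1` and `p.2`. As `F` has no circuit of length three, it opposes the
    -- order on `(p.1, z)` or on `(z, p.2)`, contradicting minimality.
    rcases hF.total (iz (fst_mem_span (.refl p))) with h3 | h3
    · rcases hF.total (iz (snd_mem_span (.refl p))) with h4 | h4
      · have hsp := span_swap (c := c) p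
        have iz' := iz (snd_mem_span (.refl p))
        obtain ⟨r, hr, h5⟩ := exists_disagrees_between hQ.swap hF.swap (p := p.swap) ip.symm
          (hsp.symm ▸ hz) (hsp.symm ▸ hw) h (endOrder_swap hQ iz'.symm h2)
          (endOrder_swap hQ (iz (fst_mem_span (.refl p))) h1) h4
        rw [between_swap] at h5
        refine hmin' r.swap hr.swap ?_
        rw [← between_swap]
        exact h5
      · exact hF.acyclic h3 h4 hFp
    · obtain ⟨r, hr, h4⟩ := exists_disagrees_between hQ hF ip hz hw h h1 h2 h3
      exact hmin' r hr h4
  · exact absurd (hQ.endOrder_trans h2 (hQ.endOrder_trans h1 h0)) (hQ.endOrder_irrefl _)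
  · exact Or.inr (after h1 h2)

/-- A disagreement inside the reversed set whose span is the whole set would lie in the component of
`p`, which has just been turned around, or in its coupled component, contradicting the asymmetry of
`F`. -/
theorem exists_improvement [Finite V] {p : V × V} (hp : Disagrees H F Q p)
    (hU : IsReversible c (span c p) Q) {q : V × V} (hq : Disagrees H F (reverseOn c (span c p) Q) q) :
    (Disagrees H F Q q ∧ ¬ (q.1 ∈ span c p ∧ q.2 ∈ span c p)) ∨
      (span c q).ncard < (span c p).ncard := by
  by_cases hin : q.1 ∈ span c p ∧ q.2 ∈ span c p
  · right
    refine Set.ncard_lt_ncard (LE.le.ssubset_of_ne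
      (span_subset_span hp.1 hq.1 hin.1 hin.2) fun h => ?_) (Set.toFinite _)
    have h1 : Q q.2 q.1 := (reverseOn_in_in hin.1 hin.2).1 hq.2.1
    rcases linked_of_span_eq hp.1 hq.1 h.symm with h2 | h2
    · have h3 := hQ.endOrder_of_linked h2 ((hQ.endOrder_iff (hQ.color hp.2.1) hp.1.not_adj).2 hp.2.1)
      exact hQ.asymm h1 ((hQ.endOrder_iff (hQ.color h1).symm hq.1.not_adj).1 h3)
    · exact hF.asymm hq.2.2 (hF.linked (p := p.swap) hp.2.2 h2.swap)
  · left
    exact ⟨⟨hq.1, hU.arrow_of_reverseOn hQ hq.1 hin hq.2.1, hq.2.2⟩, hin⟩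

end

/-! ### Termination of the repeated reversals. -/

open Classical in
/-- A weighted count of the arrows that disagree with the selection. -/
noncomputable def defect [Fintype V] (c : H.Coloring Bool) (F Q : V → V → Prop) : ℕ :=
  ∑ p : V × V with Disagrees H F Q p, (Fintype.card (V × V) + 1) ^ (span c p).ncard

theorem exists_defect_lt [Fintype V] {Q F : V → V → Prop} (hQ : IsOrientation H c Q)
    (hF : IsSelection c F) {p₀ : V × V} (h₀ : Disagrees H F Q p₀) :
    ∃ Q', IsOrientation H c Q' ∧ defect c F Q' < defect c F Q := by
  classical
  obtain ⟨p, hp, hU⟩ := exists_isReversible hQ hF h₀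
  refine ⟨_, hU.isOrientation_reverseOn hQ, ?_⟩
  set U := span c p with hUdef
  set M := Fintype.card (V × V) + 1 with hM
  have hpos : 0 < U.ncard := (Set.ncard_pos (Set.toFinite _)).2 ⟨p.1, fst_mem_span (.refl p)⟩
  have h1 : ∀ q, Disagrees H F (reverseOn c U Q) q →
      (Disagrees H F Q q ∧ ¬ (q.1 ∈ U ∧ q.2 ∈ U)) ∨ (span c q).ncard < U.ncard :=
    fun q hq => exists_improvement hQ hF hp hU hq
  set A := Finset.univ.filter fun q : V × V => Disagrees H F Q q ∧ ¬ (q.1 ∈ U ∧ q.2 ∈ U) with hA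
  set B := Finset.univ.filter fun q : V × V => (span c q).ncard < U.ncard with hB
  have h2 : defect c F (reverseOn c U Q) ≤
      ∑ q ∈ A, M ^ (span c q).ncard + ∑ q ∈ B, M ^ (span c q).ncard := by
    refine le_trans ?_ (Finset.sum_union_inter.le.trans' (Nat.le_add_right _ _))
    refine Finset.sum_le_sum_of_subset fun q hq => ?_
    simp only [Finset.mem_filter, Finset.mem_univ, true_and, Finset.mem_union, hA, hB] at hq ⊢
    exact h1 q hq
  -- The base `M` exceeds the number of pairs, so all pairs of smaller span together weigh less than
  -- one pair of span `U`.
  have h3 : ∑ q ∈ B, M ^ (span c q).ncard < M ^ U.ncard := by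
    calc ∑ q ∈ B, M ^ (span c q).ncard ≤ ∑ _q ∈ B, M ^ (U.ncard - 1) := by
          refine Finset.sum_le_sum fun q hq => Nat.pow_le_pow_right (by omega) ?_
          have := (Finset.mem_filter.1 hq).2
          omega
      _ = B.card * M ^ (U.ncard - 1) := by simp
      _ < M * M ^ (U.ncard - 1) := by
          refine Nat.mul_lt_mul_of_pos_right ?_ (Nat.pow_pos (by omega))
          exact lt_of_le_of_lt (Finset.card_le_univ B) (by omega)
      _ = M ^ U.ncard := by
          rw [← Nat.pow_succ']
          congr 1
          omega
  -- The pair `p` lies inside `U`, hence outside `A`, and its weight is gained.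
  have h4 : ∑ q ∈ A, M ^ (span c q).ncard + M ^ U.ncard ≤ defect c F Q := by
    have hpA : p ∉ A := by
      intro h
      rw [hA, Finset.mem_filter] at h
      exact h.2.2 ⟨fst_mem_span (.refl p), snd_mem_span (.refl p)⟩
    rw [add_comm, hUdef, ← Finset.sum_insert (f := fun q => M ^ (span c q).ncard) hpA]
    refine Finset.sum_le_sum_of_subset fun q hq => ?_
    simp only [hA, Finset.mem_insert, Finset.mem_filter, Finset.mem_univ, true_and] at hq ⊢
    rcases hq with rfl | hq
    · exact hp
    · exact hq.1
  omega

/-- Some orientation agrees with a given selection, if there is any orientation. -/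
theorem exists_orientation_agreeing [Finite V] {Q F : V → V → Prop} (hQ : IsOrientation H c Q)
    (hF : IsSelection c F) : ∃ Q', IsOrientation H c Q' ∧ ∀ p, ¬ Disagrees H F Q' p := by
  have := Fintype.ofFinite V
  obtain ⟨Q', hQ', hmin⟩ := (measure fun Q => defect c F Q).wf.has_min
    {Q | IsOrientation H c Q} ⟨Q, hQ⟩
  refine ⟨Q', hQ', fun p hp => ?_⟩
  obtain ⟨Q₁, h1, h2⟩ := exists_defect_lt hQ' hF hp
  exact hmin Q₁ h1 h2

/-! ### Back to the algorithm: components, selections and codes. -/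

theorem IsStrongComponent.linked {S : Set (V × V)} (hS : IsStrongComponent H c S) {p q : V × V}
    (hp : p ∈ S) (hq : q ∈ S) : Linked c p q := by
  obtain ⟨r, -, rfl⟩ := hS
  exact ⟨hp.2.2.trans hq.2.1, hq.2.2.trans hp.2.1⟩

theorem IsComponent.independent {S : Set (V × V)} (hS : IsComponent H c S) {p : V × V}
    (hp : p ∈ S) : Independent H p.1 p.2 := by
  obtain ⟨q, hq, hne⟩ := hS.2.exists_ne p
  exact independent_of_linked_of_ne (hS.1.linked hp hq) hne.symm

theorem IsComponent.mem_of_linked {S : Set (V × V)} (hS : IsComponent H c S) {p q : V × V}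
    (hp : p ∈ S) (h : Linked c p q) : q ∈ S := by
  have hq : q ∈ Pairs V := ((hS.independent hp).of_linked h).ne
  obtain ⟨⟨r, -, rfl⟩, -⟩ := hS
  exact ⟨hq, hp.2.1.trans h.1, h.2.trans hp.2.2⟩

theorem Independent.exists_component (c : H.Coloring Bool) {x y : V} (h : Independent H x y) :
    ∃ S, IsComponent H c S ∧ (x, y) ∈ S := by
  obtain ⟨x₁, h1, h2⟩ := h.exists_left
  have h3 := h.linked_left c h2 h1
  refine ⟨_, ⟨⟨(x, y), h.ne, rfl⟩, ?_⟩, h.ne, .refl, .refl⟩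
  refine ⟨(x, y), ⟨h.ne, .refl, .refl⟩, (x₁, y), ⟨h2.ne, h3.1, h3.2⟩, ?_⟩
  simpa using h1.ne

theorem Step2.isComponent {sel : Set (Set (V × V))} (h : Step2 H c sel) :
    ∀ S ∈ sel, IsComponent H c S := by
  induction h with
  | start => simp
  | select _ hS _ _ _ ih =>
    rintro T (rfl | hT)
    · exact hS
    · exact ih T hT

theorem Step2.not_hasCircuit {sel : Set (Set (V × V))} (h : Step2 H c sel) :
    ¬ HasCircuit (selectedPairs H c sel) := by
  cases h with
  | start =>
    rintro ⟨n, x, hx⟩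
    simpa [selectedPairs] using hx 0
  | select _ _ _ _ h => exact h

theorem mem_selectedPairs {sel : Set (Set (V × V))} {S : Set (V × V)} (hS : S ∈ sel) {p : V × V}
    (hp : p ∈ S) : p ∈ selectedPairs H c sel :=
  Set.mem_biUnion hS (Or.inl hp)

theorem Step2Output.isSelection {sel : Set (Set (V × V))} (h : Step2Output H c sel) :
    IsSelection c fun x y => ∃ S ∈ sel, (x, y) ∈ S where
  linked := by
    rintro p q ⟨S, hS, hp⟩ hpq
    exact ⟨S, hS, (h.1.isComponent S hS).mem_of_linked hp hpq⟩
  total := by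
    intro x y hxy
    obtain ⟨S, hS, hp⟩ := hxy.exists_component c
    rcases h.2 S hS with h1 | h1
    · exact Or.inl ⟨S, h1, hp⟩
    · exact Or.inr ⟨_, h1, hp⟩
  asymm := by
    rintro x y ⟨S, hS, h1⟩ ⟨T, hT, h2⟩
    exact h.1.not_hasCircuit (hasCircuit_two (mem_selectedPairs hS h1) (mem_selectedPairs hT h2))
  acyclic := by
    rintro x y z ⟨S, hS, h1⟩ ⟨T, hT, h2⟩ ⟨R, hR, h3⟩
    exact h.1.not_hasCircuit (hasCircuit_three (mem_selectedPairs hS h1) (mem_selectedPairs hT h2)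
      (mem_selectedPairs hR h3))

/-- If the envelope of some complete set has no circuit, then neither has the envelope of any set
obtained in the second step. -/
theorem Step2Output.not_hasCircuit_envelope [Finite V] {sel : Set (Set (V × V))}
    (h : Step2Output H c sel) {D : Set (V × V)} (hD : IsComplete H c D)
    (hE : ¬ HasCircuit (envelope H c D)) : ¬ HasCircuit (envelope H c (selectedPairs H c sel)) := by
  obtain ⟨Q, hQ, hagree⟩ := exists_orientation_agreeing
    (isOrientation_of_envelope hD hE fun h => h.exists_component c) h.isSelection
  have hmem : ∀ S ∈ sel, ∀ p ∈ S, endOrder H Q p.1 p.2 := by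
    intro S hS p hp
    have ip := (h.1.isComponent S hS).independent hp
    rcases endOrder_or_of_independent hQ ip with h1 | h1
    · exact h1
    · exfalso
      -- A selected pair pointing the wrong way has a two-coloured representative in its component,
      -- which would be a disagreement.
      obtain ⟨b, hb, hcb⟩ := exists_linked_color_ne (c := c) ip
      have ib : Independent H p.1 b := ip.of_linked hb
      exact hagree (b, p.1) ⟨ib.symm, (hQ.endOrder_iff hcb.symm ib.symm.not_adj).1
        (hQ.endOrder_of_linked hb.swap h1), S, hS, (h.1.isComponent S hS).mem_of_linked hp hb⟩
  refine not_hasCircuit_of_strictOrder (fun p hp => hQ.endOrder_envelope (fun q hq => ?_) hp)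
    hQ.endOrder_irrefl hQ.endOrder_trans
  obtain ⟨S, hS, hq⟩ := Set.mem_iUnion₂.1 hq
  rcases hq with hq | ⟨r, hr, ha⟩
  · exact hmem S hS q hq
  · exact hQ.endOrder_arc (hmem S hS r hr) ha

/-- If the second step leads to an envelope with a circuit, then so does every complete set, and
hence every component is a dictator. -/
theorem IsComponent.isDictator [Finite V] {sel : Set (Set (V × V))} (h : Step2Output H c sel)
    (hcircuit : HasCircuit (envelope H c (selectedPairs H c sel))) {S : Set (V × V)}
    (hS : IsComponent H c S) : IsDictator H c S :=
  ⟨hS, fun _ hD _ => by_contra fun hE => h.not_hasCircuit_envelope hD hE hcircuit⟩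

/-- Used to see that a circuit in the envelope forces at least one component to have been selected.
-/
theorem not_hasCircuit_envelope_of_forall_notMem {R : Set (V × V)} (hR : ∀ p, p ∉ R) :
    ¬ HasCircuit (envelope H c R) := by
  have key : ∀ p, ¬ envelope H c R p := by
    intro p hp
    induction hp with
    | base h => exact hR _ h
    | impl _ _ ih => exact ih
    | trans _ _ _ ih _ => exact ih
  rintro ⟨n, x, hx⟩
  exact key _ (hx 0)

/-- Each rule names a component or copies an earlier code, so the choice among the rules is
immaterial. -/
theorem DictRule.isComponent {D : Set (V × V)} {dict : V × V → Set (V × V)}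
    (hD : ∀ p ∈ D, IsComponent H c (dict p)) {p : V × V} {S : Set (V × V)}
    (h : DictRule H c D dict p S) : IsComponent H c S := by
  cases h with
  | ofComponent h _ => exact h
  | implDiff _ h _ => exact hD _ h
  | implSame _ h _ => exact hD _ h
  | transSame _ _ h => exact hD _ h
  | transDiff _ h _ => exact hD _ h

theorem isComponent_update {D : Set (V × V)} {dict : V × V → Set (V × V)}
    [DecidableEq (V × V)] (hD : ∀ p ∈ D, IsComponent H c (dict p)) {p : V × V} {S : Set (V × V)}
    (h : IsComponent H c S) : ∀ q ∈ insert p D, IsComponent H c (Function.update dict p S q) := by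
  intro q hq
  by_cases hqp : q = p
  · subst hqp
    simpa using h
  · rw [Function.update_of_ne hqp]
    exact hD q (hq.resolve_left hqp)

theorem Step3.isComponent {sel : Set (Set (V × V))} {D : Set (V × V)}
    {dict : V × V → Set (V × V)} {DT : Set (Set (V × V))} (h : Step3 H c sel D dict DT) :
    (∀ p ∈ D, IsComponent H c (dict p)) ∧ ∀ S ∈ DT, IsComponent H c S := by
  classical
  induction h with
  | start h => exact ⟨fun p hp => (h p hp).1, by simp⟩
  | add _ _ _ hr _ ih =>
    refine ⟨?_, ih.2⟩
    intro q hq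
    convert isComponent_update ih.1 (hr.isComponent ih.1) q hq
  | addClosing _ _ _ hr _ ih =>
    refine ⟨?_, ?_⟩
    · intro q hq
      convert isComponent_update ih.1 (hr.isComponent ih.1) q hq
    · rintro T (rfl | hT)
      · exact hr.isComponent ih.1
      · exact ih.2 T hT

/-- A new circuit must pass through the pair just added, whose code is then recorded. -/
theorem Step3.not_hasCircuit {sel : Set (Set (V × V))} (hsel : Step2 H c sel) {D : Set (V × V)}
    {dict : V × V → Set (V × V)} {DT : Set (Set (V × V))} (h : Step3 H c sel D dict DT)
    (hDT : DT = ∅) : ¬ HasCircuit D := by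
  induction h with
  | start _ => exact hsel.not_hasCircuit
  | add _ _ _ _ hn ih =>
    rintro ⟨n, x, hx⟩
    refine ih hDT ⟨n, x, fun i => (hx i).resolve_left fun h => hn ⟨n, x, hx, i, h.symm⟩⟩
  | addClosing _ _ _ _ _ _ => exact absurd hDT (Set.insert_nonempty _ _).ne_empty

end IntervalBigraph

theorem mainTheorem3 {V : Type*} [Finite V] (H : SimpleGraph V) (c : H.Coloring Bool)
    (hconn : H.Connected) (hstep1 : IntervalBigraph.PassesStep1 H c)
    (sel : Set (Set (V × V))) (hstep2 : IntervalBigraph.Step2Output H c sel)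
    (hcircuit : IntervalBigraph.HasCircuit
      (IntervalBigraph.envelope H c (IntervalBigraph.selectedPairs H c sel))) :
    -- some selected component is a dictator
    (∃ S ∈ sel, IntervalBigraph.IsDictator H c S) ∧
    -- whenever adding a pair closes a circuit, the code recorded for it is a dictator
    (∀ D dict DT, IntervalBigraph.Step3 H c sel D dict DT →
      (∀ S ∈ DT, IntervalBigraph.IsDictator H c S) ∧
      (∀ p, ¬ IntervalBigraph.IsSimple H c p → IntervalBigraph.LiesOnCircuit D p →
        IntervalBigraph.IsDictator H c (dict p))) ∧
    -- once the whole envelope has been computed, at least one dictator has been recorded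
    (∀ dict DT, IntervalBigraph.Step3 H c sel
        (IntervalBigraph.envelope H c (IntervalBigraph.selectedPairs H c sel)) dict DT →
      DT.Nonempty) := by
  refine ⟨?_, fun D dict DT h => ⟨fun S hS => ?_, fun p _ hp => ?_⟩, fun dict DT h => ?_⟩
  · by_contra! hn
    refine IntervalBigraph.not_hasCircuit_envelope_of_forall_notMem (fun p hp => ?_) hcircuit
    obtain ⟨S, hS, -⟩ := Set.mem_iUnion₂.1 hp
    exact hn S hS ((hstep2.1.isComponent S hS).isDictator hstep2 hcircuit)
  · exact (h.isComponent.2 S hS).isDictator hstep2 hcircuit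
  · obtain ⟨n, x, hx, i, rfl⟩ := hp
    exact (h.isComponent.1 _ (hx i)).isDictator hstep2 hcircuit
  · by_contra hn
    exact h.not_hasCircuit hstep2.1 (Set.not_nonempty_iff_eq_empty.1 hn) hcircuit
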